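/- Let $\Omega\subset\mathbb{C}^n$ be a bounded pseudo-convex domain with $\mathcal{C}^\infty$ boundary, and let $\rho$ be a smooth defining function of $\Omega$ (that is, $\rho$ is real and $\mathcal{C}^\infty$ on an open neighbourhood $U$ of $\overline\Omega$, $\Omega=\{z\in U:\rho(z)<0\}$ and $\nabla\rho\ne0$ on $\partial\Omega$) such that, for some $s\in\,]0,1]$, $-(-\rho)^s$ is strictly plurisubharmonic in $\Omega$ (a Diederich–Fornæss defining function). Let $h:\mathbb{C}^m\to\mathbb{R}$ satisfy Condition III, that is, $h(w)=\sum_{i=1}^m h_i(w_i)$ for $w=(w_1,\dots,w_m)$, $w_i\in\mathbb{C}$, where each $h_i:\mathbb{C}\to\mathbb{R}$ is $\mathcal{C}^\infty$, non-negative and subharmonic and satisfies: 1. $h_i(w)=0\iff w=0$; $\nabla h_i(w)\neq0$ if $w\ne0$; $h_i(w)\to+\infty$ as $|w|\to+\infty$; 2. $\log h_i$ is subharmonic, i.e. $\frac{\partial^2h_i}{\partial w\,\partial\overline w}\ge\frac1{h_i}\left|\frac{\partial h_i}{\partial w}\right|^2$ for $w\neq 0$, and $h_i$ is strictly subharmonic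 outside the origin, i.e. $\frac{\partial^2h_i}{\partial w\,\partial\overline w}>0$ there; 3. $h_i$ is of finite type at the origin, i.e. $\sup_\varphi \frac{\mathrm{ord}_0(h_i\circ\varphi)}{\mathrm{ord}_0(\varphi)}<+\infty$, the supremum being over all non-zero holomorphic functions $\varphi$ from the unit disc to $\mathbb{C}$ with $\varphi(0)=0$, where $\mathrm{ord}_0$ is the least order of a non-vanishing derivative at $0$; 4. there is a $\mathcal{C}^\infty$ function $\alpha_i$ on a neighbourhood of $0$ in $\mathbb{C}$ such that $\lim_{w\to0}\alpha_i(w)=0$ and $\frac{\partial h_i}{\partial w}=\alpha_i\,\frac{\partial^2h_i}{\partial w\,\partial\overline w}$ in that neighbourhood. Put $r(z,w)=\rho(z)+h(w)$ and $\widetilde\Omega=\{(z,w)\in U\times\mathbb{C}^m: r(z,w)<0\}$. Assume that at every point $z\in\partial\Omega$ the Levi form of $\rho$, that is, the restriction of $\partial\overline\partial\rho(z)$ to the complex tangent space $\{t\in\mathbb{C}^n:\sum_i\frac{\partial\rho}{\partial z_i}(z)\,t_i=0\}$, has rank $\ge n-2$. Then $\widetilde\Omega$ has a locally diagonalizable Levi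 form at every point of its boundary: every $p\in\partial\widetilde\Omega$ has an open neighbourhood $V$ on which $r$ is $\mathcal{C}^\infty$ with $\nabla r\neq0$ and on which there are $n+m-1$ vector fields $L_1,\dots,L_{n+m-1}$ of type $(1,0)$ with $\mathcal{C}^\infty$ coefficients such that, at each point of $V$, $L_1,\dots,L_{n+m-1}$ form a basis of the space of $(1,0)$ vectors $L$ with $\langle\partial r,L\rangle=0$, and $\left\langle\partial\overline\partial r;L_i,\overline{L_j}\right\rangle=0$ whenever $i\ne j$. -/

import Mathlib

open Set Filter Topology
open scoped ContDiff ENNReal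

noncomputable section

namespace Hartogs

section Calculus

variable {E : Type*} [NormedAddCommGroup E] [NormedSpace ℂ E]

/-- The `(1,0)` derivative `∂g(z)`, as a complex linear form on the space: in coordinates
`∂g(z)(t) = ∑ i, t i * ∂g/∂z_i (z)`. A vector `t` stands for the `(1,0)` tangent vector
`∑ i, t i * ∂/∂z_i`. -/
def del (g : E → ℂ) (z : E) : E →ₗ[ℂ] ℂ where
  toFun t := (fderiv ℝ g z t - Complex.I * fderiv ℝ g z (Complex.I • t)) / 2
  map_add' s t := by
    simp only [smul_add, map_add]
    ring
  map_smul' c t := by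
    have h1 : c • t = c.re • t + c.im • (Complex.I • t) := by
      conv_lhs => rw [← Complex.re_add_im c]
      rw [add_smul, mul_smul]
      rfl
    have h2 : Complex.I • (c • t) = c.re • (Complex.I • t) - c.im • t := by
      rw [h1, smul_add, smul_comm Complex.I c.re, smul_comm Complex.I c.im, smul_smul Complex.I,
        Complex.I_mul_I, neg_one_smul, smul_neg, sub_eq_add_neg]
    have hI := Complex.I_mul_I
    rw [h2, h1]
    simp only [map_add, map_sub, map_smul, RingHom.id_apply, smul_eq_mul, Complex.real_smul]
    conv_rhs => rw [← Complex.re_add_im c]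
    linear_combination (c.im : ℂ) * fderiv ℝ g z (Complex.I • t) / 2 * hI

/-- The `(0,1)` derivative: in coordinates
`delBar g z t = ∑ j, conj (t j) * ∂g/∂(conj z_j) (z)`. -/
def delBar (g : E → ℂ) (z t : E) : ℂ :=
  (fderiv ℝ g z t + Complex.I * fderiv ℝ g z (Complex.I • t)) / 2

/-- The form `⟨∂∂̄f(z); s, t̄⟩ = ∑ i j, ∂²f/∂z_i∂(conj z_j) (z) * s i * conj (t j)` of a
real function `f`. -/
def complexHessian (f : E → ℝ) (z s t : E) : ℂ :=
  del (fun y => delBar (fun x => (f x : ℂ)) y t) z s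

/-- The complex tangent space at `z` of the level set of `f` through `z`: the vectors `t` with
`∑ i, ∂f/∂z_i (z) * t i = 0`. -/
def complexTangent (f : E → ℝ) (z : E) : Submodule ℂ E :=
  LinearMap.ker (del (fun x => (f x : ℂ)) z)

/-- The Levi form of `f` at `z`, i.e. the restriction of `∂∂̄f(z)` to the complex tangent space
`T`, as the map which sends `s` in `T` to the function `t ↦ ⟨∂∂̄f(z); s, t̄⟩` on `T`. -/
def leviMap (f : E → ℝ) (z : E) :
    complexTangent f z →ₗ[ℂ] (complexTangent f z → ℂ) :=
  LinearMap.pi fun t =>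
    (del (fun y => delBar (fun x => (f x : ℂ)) y (t : E)) z).comp (complexTangent f z).subtype

/-- The rank of the Levi form of `f` at `z`. -/
def leviRank (f : E → ℝ) (z : E) : ℕ :=
  Module.finrank ℂ (LinearMap.range (leviMap f z))

/-- `f` is strictly plurisubharmonic on `D` (for `f` twice continuously differentiable near each
point of the open set `D`): its complex Hessian is positive definite. -/
def StrictlyPlurisubharmonicOn (f : E → ℝ) (D : Set E) : Prop :=
  ∀ z ∈ D, ∀ t : E, t ≠ 0 → 0 < (complexHessian f z t t).re

/-- `r`, smooth on the open neighbourhood `U` of the closure of `D`, is a smooth defining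
function of `D`. -/
structure IsDefiningFunction (D U : Set E) (r : E → ℝ) : Prop where
  isOpen : IsOpen U
  closure_subset : closure D ⊆ U
  smooth : ContDiffOn ℝ ∞ r U
  eq_neg : D = {z | z ∈ U ∧ r z < 0}
  grad_ne : ∀ z ∈ frontier D, fderiv ℝ r z ≠ 0

/-- `D` is a bounded pseudoconvex domain with smooth boundary, with smooth defining function `r`
on `U`. (Levi) pseudoconvexity does not depend on the choice of the defining function. -/
structure IsSmoothBoundedPseudoconvex (D U : Set E) (r : E → ℝ) : Prop where
  connected : IsConnected D
  bounded : Bornology.IsBounded D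
  defining : IsDefiningFunction D U r
  levi_nonneg : ∀ z ∈ frontier D, ∀ t ∈ complexTangent r z, 0 ≤ (complexHessian r z t t).re

/-- `r` is a Diederich–Fornæss defining function with exponent `s`: `-(-r)^s` is strictly
plurisubharmonic in `D`. -/
def IsDiederichFornaess (D : Set E) (r : E → ℝ) (s : ℝ) : Prop :=
  0 < s ∧ s ≤ 1 ∧ StrictlyPlurisubharmonicOn (fun z => -(-r z) ^ s) D

/-- `D` has a smooth boundary near `p` with local defining function `r`, and its Levi form is
locally diagonalizable at `p`: on an open neighbourhood `V` of `p` there are smooth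
`(1,0)` vector fields `L_1, …, L_{d-1}`, with `d` the dimension of the space, which form at each
point of `V` a basis of the complex tangent space of the level set of `r`, and in which the matrix
of the Levi form of `r` is diagonal at each point of `V`. -/
def HasLocallyDiagonalizableLeviFormAt (D : Set E) (r : E → ℝ) (p : E) : Prop :=
  ∃ V : Set E, IsOpen V ∧ p ∈ V ∧ ContDiffOn ℝ ∞ r V ∧ D ∩ V = {q | q ∈ V ∧ r q < 0} ∧
    (∀ q ∈ V, fderiv ℝ r q ≠ 0) ∧
    ∃ L : Fin (Module.finrank ℂ E - 1) → E → E,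
      (∀ j, ContDiffOn ℝ ∞ (L j) V) ∧
      (∀ q ∈ V, LinearIndependent ℂ (fun j => L j q) ∧
        Submodule.span ℂ (Set.range fun j => L j q) = complexTangent r q) ∧
      ∀ q ∈ V, ∀ i j, i ≠ j → complexHessian r q (L i q) (L j q) = 0

end Calculus

section FiniteType

/-- The order of `g` at the origin: the least order of a nonzero derivative of `g` at `0`,
and `⊤` if there is none. -/
def orderAtZero {E F : Type*} [NormedAddCommGroup E] [NormedSpace ℝ E]
    [NormedAddCommGroup F] [NormedSpace ℝ F] (g : E → F) : ℕ∞ :=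
  ⨅ k ∈ {k : ℕ | iteratedFDeriv ℝ k g 0 ≠ 0}, (k : ℕ∞)

/-- The type of `f` at the origin: the supremum of `ord (f ∘ φ) / ord φ` over all nonzero
holomorphic maps `φ` from the unit disc with `φ 0 = 0`. -/
def typeAtZero {E : Type*} [NormedAddCommGroup E] [NormedSpace ℂ E] (f : E → ℝ) : ℝ≥0∞ :=
  ⨆ φ ∈ {φ : ℂ → E | DifferentiableOn ℂ φ (Metric.ball 0 1) ∧ φ 0 = 0 ∧
      ∃ ζ ∈ Metric.ball (0 : ℂ) 1, φ ζ ≠ 0},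
    (orderAtZero (f ∘ φ) : ℝ≥0∞) / (orderAtZero φ : ℝ≥0∞)

end FiniteType

/-- `∂g/∂w` for a real function `g` of one complex variable. -/
def dw (g : ℂ → ℝ) (w : ℂ) : ℂ := del (fun x => (g x : ℂ)) w 1

/-- `∂²g/∂w∂(conj w)` for a real function `g` of one complex variable. -/
def dwdwBar (g : ℂ → ℝ) (w : ℂ) : ℂ := complexHessian g w 1 1

/-- The conditions imposed on each summand `g` of `h`. In `log_psh` the plurisubharmonicity of
`log g` is written as `∂²g/∂w∂(conj w) ≥ |∂g/∂w|² / g` (outside the origin, where `g > 0`). -/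
structure IsAdmissibleSummand (g : ℂ → ℝ) : Prop where
  smooth : ContDiff ℝ ∞ g
  nonneg : ∀ w, 0 ≤ g w
  psh : ∀ w, 0 ≤ (dwdwBar g w).re
  eq_zero_iff : ∀ w, g w = 0 ↔ w = 0
  grad_ne : ∀ w, w ≠ 0 → fderiv ℝ g w ≠ 0
  tendsto : Tendsto g (cocompact ℂ) atTop
  log_psh : ∀ w, w ≠ 0 → ‖dw g w‖ ^ 2 / g w ≤ (dwdwBar g w).re
  strictly_psh : StrictlyPlurisubharmonicOn g {w | w ≠ 0}
  finite_type : typeAtZero g < ⊤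
  exists_factor : ∃ (V : Set ℂ) (α : ℂ → ℂ), IsOpen V ∧ (0 : ℂ) ∈ V ∧ ContDiffOn ℝ ∞ α V ∧
    Tendsto α (𝓝 0) (𝓝 0) ∧ ∀ w ∈ V, dw g w = α w * dwdwBar g w

/-- Condition III: `h` is a sum of admissible functions of the single variables. -/
def ConditionIII {m : ℕ} (h : (Fin m → ℂ) → ℝ) : Prop :=
  ∃ g : Fin m → ℂ → ℝ, (∀ i, IsAdmissibleSummand (g i)) ∧ ∀ w, h w = ∑ i, g i (w i)

/-- The function `r(z, w) = ρ(z) + h(w)`. -/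
def hartogsFun {n m : ℕ} (ρ : (Fin n → ℂ) → ℝ) (h : (Fin m → ℂ) → ℝ) :
    (Fin n → ℂ) × (Fin m → ℂ) → ℝ :=
  fun p => ρ p.1 + h p.2

/-- The domain `{(z, w) : ρ(z) + h(w) < 0}`, where `z` ranges over the domain `U` of `ρ`. -/
def hartogsDomain {n m : ℕ} (U : Set (Fin n → ℂ)) (ρ : (Fin n → ℂ) → ℝ)
    (h : (Fin m → ℂ) → ℝ) : Set ((Fin n → ℂ) × (Fin m → ℂ)) :=
  {p | p.1 ∈ U ∧ hartogsFun ρ h p < 0}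

end Hartogs

end

namespace Hartogs

open ComplexConjugate

/-! ### The forms `del` and `complexHessian` in terms of real derivatives. -/

section Calculus

variable {E F : Type*} [NormedAddCommGroup E] [NormedSpace ℂ E]
  [NormedAddCommGroup F] [NormedSpace ℂ F]

/-! Write H for the form ⟨∂∂̄r; ·, ·⟩ and fix a boundary point p = (z₀, w₀). Since h is a sum of
functions of the single variables, the coordinate fields e_i with (w₀)_i = 0 are H-orthogonal near p
to each other and to the constant subspace W of vectors without components along them. The
degenerate directions e_i thus separate from W; their only defect is that they are tangent at p but
not nearby.

On W ∩ T, where T is the complex tangent space at p, H has at most a one-dimensional radical. If w₀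
= 0, then z₀ ∈ ∂Ω and W ∩ T is the complex tangent space of ρ, where the rank hypothesis applies
(`not_linearIndependent_of_leviRank`). If w₀ ≠ 0, then z₀ ∈ Ω and H is positive definite on W ∩ T:
the Diederich–Fornæss inequality loses a multiple of |∂ρ(t)|², and tangency, Cauchy–Schwarz and
log-subharmonicity of the summands recover it (`levi_pos_of_diederichFornaess`).

An H-orthogonal basis of W ∩ T therefore has at most one null vector. Gram–Schmidt with the non-null
vectors as pivots extends it to smooth orthogonal tangent fields and a transversal field ν with
∂r(ν) = 1, all in W, where only the field of the null vector may fail to be orthogonal to ν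
(`exists_smooth_orthogonal_fields`).

It remains to make the e_i tangent, one at a time (`IsPartialFrame.exists_erase`). With l = H(e_i,
e_i), Condition III gives ∂r(e_i) = αl with α(p) = 0, so X = e_i − αlν is tangent. Making another
field Y orthogonal to X requires the coefficient H(Y, X)/H(X, X); both terms contain the factor l,
which may vanish, but it cancels and leaves a smooth quotient. The correction changes H(Y, Y') by a
multiple of H(Y, ν) · conj H(Y', ν), which is zero because at most one field is not orthogonal to ν.
The values at p never change, so the result is a basis of T at p, hence a frame nearby. -/

lemma fderiv_ofReal_apply {f : E → ℝ} {z : E} (hf : DifferentiableAt ℝ f z) (t : E) :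
    fderiv ℝ (fun x => (f x : ℂ)) z t = (fderiv ℝ f z t : ℂ) := by
  have h : HasFDerivAt (fun x => (f x : ℂ)) (Complex.ofRealCLM.comp (fderiv ℝ f z)) z :=
    Complex.ofRealCLM.hasFDerivAt.comp z hf.hasFDerivAt
  rw [h.fderiv]
  rfl

lemma del_ofReal_apply {f : E → ℝ} {z : E} (hf : DifferentiableAt ℝ f z) (t : E) :
    del (fun x => (f x : ℂ)) z t
      = ((fderiv ℝ f z t : ℂ) - Complex.I * (fderiv ℝ f z (Complex.I • t) : ℂ)) / 2 := by
  simp only [del, LinearMap.coe_mk, AddHom.coe_mk, fderiv_ofReal_apply hf]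

lemma delBar_ofReal_apply {f : E → ℝ} {z : E} (hf : DifferentiableAt ℝ f z) (t : E) :
    delBar (fun x => (f x : ℂ)) z t
      = ((fderiv ℝ f z t : ℂ) + Complex.I * (fderiv ℝ f z (Complex.I • t) : ℂ)) / 2 := by
  simp only [delBar, fderiv_ofReal_apply hf]

lemma re_del_ofReal {f : E → ℝ} {z : E} (hf : DifferentiableAt ℝ f z) (t : E) :
    (del (fun x => (f x : ℂ)) z t).re = fderiv ℝ f z t / 2 := by
  rw [del_ofReal_apply hf]
  simp

lemma normSq_del_ofReal {f : E → ℝ} {z : E} (hf : DifferentiableAt ℝ f z) (t : E) :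
    ‖del (fun x => (f x : ℂ)) z t‖ ^ 2
      = (fderiv ℝ f z t ^ 2 + fderiv ℝ f z (Complex.I • t) ^ 2) / 4 := by
  rw [del_ofReal_apply hf, ← Complex.normSq_eq_norm_sq, Complex.normSq_apply]
  simp
  ring

lemma del_ofReal_eq_zero_iff {f : E → ℝ} {z : E} (hf : DifferentiableAt ℝ f z) :
    del (fun x => (f x : ℂ)) z = 0 ↔ fderiv ℝ f z = 0 := by
  constructor
  · intro h
    ext t
    have := re_del_ofReal hf t
    rw [h] at this
    simpa using this.symm
  · intro h
    ext t
    rw [del_ofReal_apply hf, h]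
    simp

/-- Obtained by expanding both complex derivatives. Hermitian symmetry, smoothness and the rules for
sums and compositions are all read off from the real second derivative through this formula. -/
lemma complexHessian_eq {f : E → ℝ} {z : E} (hf : ContDiffAt ℝ 2 f z) (s t : E) :
    complexHessian f z s t
      = (((fderiv ℝ (fderiv ℝ f) z s t : ℂ)
            + (fderiv ℝ (fderiv ℝ f) z (Complex.I • s) (Complex.I • t) : ℂ))
          + Complex.I * ((fderiv ℝ (fderiv ℝ f) z s (Complex.I • t) : ℂ)
            - (fderiv ℝ (fderiv ℝ f) z (Complex.I • s) t : ℂ))) / 4 := by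
  have hd : ∀ᶠ y in 𝓝 z, DifferentiableAt ℝ f y :=
    (hf.eventually (by simp)).mono fun y hy => hy.differentiableAt (by simp)
  have h2 : DifferentiableAt ℝ (fderiv ℝ f) z :=
    (hf.fderiv_right (m := 1) (by norm_num)).differentiableAt (by simp)
  have he : (fun y => delBar (fun x => (f x : ℂ)) y t) =ᶠ[𝓝 z] fun y =>
      ((fderiv ℝ f y t : ℂ) + Complex.I * (fderiv ℝ f y (Complex.I • t) : ℂ)) / 2 :=
    hd.mono fun y hy => delBar_ofReal_apply hy t
  have hv : ∀ v : E, HasFDerivAt (fun y => ((fderiv ℝ f y v : ℝ) : ℂ))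
      (Complex.ofRealCLM.comp ((fderiv ℝ (fderiv ℝ f) z).flip v)) z := fun v =>
    Complex.ofRealCLM.hasFDerivAt.comp z
      (by simpa using h2.hasFDerivAt.clm_apply (hasFDerivAt_const v z))
  have hfd := ((hv t).add ((hv (Complex.I • t)).const_mul Complex.I)).mul_const (1 / 2 : ℂ)
  have hfd' : HasFDerivAt (fun y => ((fderiv ℝ f y t : ℂ)
      + Complex.I * (fderiv ℝ f y (Complex.I • t) : ℂ)) / 2) _ z :=
    hfd.congr_of_eventuallyEq (Eventually.of_forall fun y => by simp [div_eq_mul_inv])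
  have hI := Complex.I_mul_I
  simp only [complexHessian, del, LinearMap.coe_mk, AddHom.coe_mk]
  rw [he.fderiv_eq, hfd'.fderiv]
  simp
  linear_combination (-(fderiv ℝ (fderiv ℝ f) z (Complex.I • s) (Complex.I • t) : ℂ) / 4) * hI

lemma complexHessian_add_left (f : E → ℝ) (z x y t : E) :
    complexHessian f z (x + y) t = complexHessian f z x t + complexHessian f z y t :=
  map_add _ _ _

lemma complexHessian_sub_left (f : E → ℝ) (z x y t : E) :
    complexHessian f z (x - y) t = complexHessian f z x t - complexHessian f z y t :=
  map_sub _ _ _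

lemma complexHessian_smul_left (f : E → ℝ) (z : E) (a : ℂ) (x t : E) :
    complexHessian f z (a • x) t = a * complexHessian f z x t :=
  map_smul _ _ _

lemma complexHessian_zero_left (f : E → ℝ) (z t : E) :
    complexHessian f z 0 t = 0 :=
  map_zero _

lemma complexHessian_swap {f : E → ℝ} {z : E} (hf : ContDiffAt ℝ 2 f z) (s t : E) :
    complexHessian f z t s = conj (complexHessian f z s t) := by
  have hs : IsSymmSndFDerivAt ℝ f z := hf.isSymmSndFDerivAt (by simp)
  rw [complexHessian_eq hf, complexHessian_eq hf, hs.eq t s, hs.eq (Complex.I • t) (Complex.I • s),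
    hs.eq t (Complex.I • s), hs.eq (Complex.I • t) s]
  simp [map_ofNat]
  ring

lemma complexHessian_sub_right {f : E → ℝ} {z : E} (hf : ContDiffAt ℝ 2 f z) (t x y : E) :
    complexHessian f z t (x - y) = complexHessian f z t x - complexHessian f z t y := by
  rw [complexHessian_swap hf, complexHessian_sub_left, map_sub, ← complexHessian_swap hf,
    ← complexHessian_swap hf]

lemma complexHessian_smul_right {f : E → ℝ} {z : E} (hf : ContDiffAt ℝ 2 f z) (a : ℂ) (t x : E) :
    complexHessian f z t (a • x) = conj a * complexHessian f z t x := by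
  rw [complexHessian_swap hf, complexHessian_smul_left, map_mul, ← complexHessian_swap hf]

lemma complexHessian_sum_left {ι : Type*} (f : E → ℝ) (z : E) (S : Finset ι) (x : ι → E) (t : E) :
    complexHessian f z (∑ i ∈ S, x i) t = ∑ i ∈ S, complexHessian f z (x i) t :=
  map_sum _ _ _

lemma complexHessian_sum_right {ι : Type*} {f : E → ℝ} {z : E} (hf : ContDiffAt ℝ 2 f z)
    (S : Finset ι) (t : E) (x : ι → E) :
    complexHessian f z t (∑ i ∈ S, x i) = ∑ i ∈ S, complexHessian f z t (x i) := by
  rw [complexHessian_swap hf, complexHessian_sum_left, map_sum]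
  exact Finset.sum_congr rfl fun i _ => (complexHessian_swap hf _ _).symm

/-- Derivative of a composition with a complex linear map. -/
lemma del_comp_clm {g : F → ℝ} {L : E →L[ℂ] F} {z : E} (hg : DifferentiableAt ℝ g (L z)) (t : E) :
    del (fun x => (g (L x) : ℂ)) z t = del (fun x => (g x : ℂ)) (L z) (L t) := by
  have h : HasFDerivAt (fun x => g (L x)) ((fderiv ℝ g (L z)).comp (L.restrictScalars ℝ)) z :=
    hg.hasFDerivAt.comp z (L.restrictScalars ℝ).hasFDerivAt
  rw [del_ofReal_apply h.differentiableAt, del_ofReal_apply hg, h.fderiv]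
  simp

lemma complexHessian_comp_clm {g : F → ℝ} {L : E →L[ℂ] F} {z : E} (hg : ContDiffAt ℝ 2 g (L z))
    (s t : E) :
    complexHessian (fun x => g (L x)) z s t = complexHessian g (L z) (L s) (L t) := by
  have hL : ContDiffAt ℝ 2 (fun x => L x) z := (L.restrictScalars ℝ).contDiff.contDiffAt
  have hLc : Tendsto (fun x => L x) (𝓝 z) (𝓝 (L z)) := L.continuous.continuousAt
  have hc : ContDiffAt ℝ 2 (fun x => g (L x)) z := hg.comp z hL
  have he : fderiv ℝ (fun x => g (L x)) =ᶠ[𝓝 z] fun y =>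
      (fderiv ℝ g (L y)).comp (L.restrictScalars ℝ) := by
    filter_upwards [hLc.eventually (hg.eventually (by simp))] with y hy
    exact ((hy.differentiableAt (by simp)).hasFDerivAt.comp y
      (L.restrictScalars ℝ).hasFDerivAt).fderiv
  have h2 : HasFDerivAt (fderiv ℝ g) (fderiv ℝ (fderiv ℝ g) (L z)) (L z) :=
    ((hg.fderiv_right (m := 1) (by norm_num)).differentiableAt (by simp)).hasFDerivAt
  have h3 : HasFDerivAt (fun y => fderiv ℝ g (L y))
      ((fderiv ℝ (fderiv ℝ g) (L z)).comp (L.restrictScalars ℝ)) z :=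
    h2.comp z (L.restrictScalars ℝ).hasFDerivAt
  have h4 := h3.clm_comp (hasFDerivAt_const (L.restrictScalars ℝ) z)
  have key : ∀ x y, fderiv ℝ (fderiv ℝ (fun x => g (L x))) z x y
      = fderiv ℝ (fderiv ℝ g) (L z) (L x) (L y) := by
    intro x y
    rw [he.fderiv_eq, h4.fderiv]
    simp
  rw [complexHessian_eq hc, complexHessian_eq hg]
  simp only [key, map_smul]

lemma fderiv_fderiv_add {f g : E → ℝ} {z : E} (hf : ContDiffAt ℝ 2 f z) (hg : ContDiffAt ℝ 2 g z)
    (s t : E) :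
    fderiv ℝ (fderiv ℝ (fun x => f x + g x)) z s t
      = fderiv ℝ (fderiv ℝ f) z s t + fderiv ℝ (fderiv ℝ g) z s t := by
  have he : fderiv ℝ (fun x => f x + g x) =ᶠ[𝓝 z] fun y => fderiv ℝ f y + fderiv ℝ g y := by
    filter_upwards [hf.eventually (by simp), hg.eventually (by simp)] with y h1 h2
    exact fderiv_fun_add (h1.differentiableAt (by simp)) (h2.differentiableAt (by simp))
  rw [he.fderiv_eq, fderiv_fun_add
    ((hf.fderiv_right (m := 1) (by norm_num)).differentiableAt (by simp))
    ((hg.fderiv_right (m := 1) (by norm_num)).differentiableAt (by simp))]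
  rfl

lemma complexHessian_add {f g : E → ℝ} {z : E} (hf : ContDiffAt ℝ 2 f z)
    (hg : ContDiffAt ℝ 2 g z) (s t : E) :
    complexHessian (fun x => f x + g x) z s t = complexHessian f z s t + complexHessian g z s t := by
  rw [complexHessian_eq (hf.add hg), complexHessian_eq hf, complexHessian_eq hg]
  simp only [fderiv_fderiv_add hf hg]
  push_cast
  ring

lemma del_add {f g : E → ℝ} {z : E} (hf : DifferentiableAt ℝ f z)
    (hg : DifferentiableAt ℝ g z) (t : E) :
    del (fun x => ((f x + g x : ℝ) : ℂ)) z t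
      = del (fun x => (f x : ℂ)) z t + del (fun x => (g x : ℂ)) z t := by
  rw [del_ofReal_apply (hf.fun_add hg), del_ofReal_apply hf, del_ofReal_apply hg,
    fderiv_fun_add hf hg]
  simp
  ring

lemma complexHessian_const (c : ℝ) (z s t : E) :
    complexHessian (fun _ => c) z s t = 0 := by
  rw [complexHessian_eq contDiffAt_const]
  simp

lemma del_const (c : ℝ) (z t : E) : del (fun _ : E => (c : ℂ)) z t = 0 := by
  rw [del_ofReal_apply (f := fun _ : E => c) (differentiableAt_const c)]
  simp

lemma complexHessian_sum {ι : Type*} (S : Finset ι) {f : ι → E → ℝ} {z : E}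
    (hf : ∀ i ∈ S, ContDiffAt ℝ 2 (f i) z) (s t : E) :
    complexHessian (fun x => ∑ i ∈ S, f i x) z s t = ∑ i ∈ S, complexHessian (f i) z s t := by
  classical
  induction S using Finset.induction_on with
  | empty => simpa using complexHessian_const 0 z s t
  | insert a S ha ih =>
    have h1 := hf a (Finset.mem_insert_self a S)
    have h2 := fun i hi => hf i (Finset.mem_insert_of_mem hi)
    simp only [Finset.sum_insert ha]
    rw [complexHessian_add h1 (ContDiffAt.sum h2), ih h2]

lemma del_sum {ι : Type*} (S : Finset ι) {f : ι → E → ℝ} {z : E}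
    (hf : ∀ i ∈ S, DifferentiableAt ℝ (f i) z) (t : E) :
    del (fun x => ((∑ i ∈ S, f i x : ℝ) : ℂ)) z t
      = ∑ i ∈ S, del (fun x => (f i x : ℂ)) z t := by
  classical
  induction S using Finset.induction_on with
  | empty => simpa using del_const 0 z t
  | insert a S ha ih =>
    have h1 := hf a (Finset.mem_insert_self a S)
    have h2 := fun i hi => hf i (Finset.mem_insert_of_mem hi)
    simp only [Finset.sum_insert ha]
    rw [del_add h1 (DifferentiableAt.fun_sum h2), ih h2]

/-- The complex Hessian of a composition with a function of one real variable. -/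
lemma complexHessian_comp_real {f : E → ℝ} {z : E} (hf : ContDiffAt ℝ 2 f z) {φ φ' : ℝ → ℝ}
    {φ'' : ℝ} (hφ : ContDiffAt ℝ 2 φ (f z)) (h1 : ∀ᶠ x in 𝓝 (f z), HasDerivAt φ (φ' x) x)
    (h2 : HasDerivAt φ' φ'' (f z)) (t : E) :
    (complexHessian (fun x => φ (f x)) z t t).re
      = φ' (f z) * (complexHessian f z t t).re + φ'' * ‖del (fun x => (f x : ℂ)) z t‖ ^ 2 := by
  have he : fderiv ℝ (fun x => φ (f x)) =ᶠ[𝓝 z] fun y => φ' (f y) • fderiv ℝ f y := by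
    filter_upwards [hf.continuousAt.eventually h1, hf.eventually (by simp)] with y hy hfy
    exact (hy.comp_hasFDerivAt y (hfy.differentiableAt (by simp)).hasFDerivAt).fderiv
  have h3 : HasFDerivAt (fderiv ℝ f) (fderiv ℝ (fderiv ℝ f) z) z :=
    ((hf.fderiv_right (m := 1) (by norm_num)).differentiableAt (by simp)).hasFDerivAt
  have hd := hf.differentiableAt (by simp)
  have h4 := (h2.comp_hasFDerivAt z hd.hasFDerivAt).smul h3
  have key : ∀ x y, fderiv ℝ (fderiv ℝ (fun x => φ (f x))) z x y
      = φ' (f z) * fderiv ℝ (fderiv ℝ f) z x y + φ'' * (fderiv ℝ f z x * fderiv ℝ f z y) := by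
    intro x y
    rw [he.fderiv_eq]
    erw [h4.fderiv]
    simp
    ring
  have hc : ContDiffAt ℝ 2 (fun x => φ (f x)) z := hφ.comp z hf
  rw [complexHessian_eq hc, complexHessian_eq hf, normSq_del_ofReal hd]
  simp only [key]
  simp
  ring

end Calculus

/-! ### Germs of smooth maps at a point. -/

section SmoothNear

variable {E F : Type*} [NormedAddCommGroup E] [NormedSpace ℝ E]
  [NormedAddCommGroup F] [NormedSpace ℝ F]

/-- `f` is infinitely differentiable on a neighbourhood of `p`. -/
def SmoothNear (f : E → F) (p : E) : Prop := ∀ᶠ q in 𝓝 p, ContDiffAt ℝ ∞ f q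

lemma SmoothNear.contDiffAt {f : E → F} {p : E} (h : SmoothNear f p) : ContDiffAt ℝ ∞ f p :=
  h.self_of_nhds

lemma SmoothNear.continuousAt {f : E → F} {p : E} (h : SmoothNear f p) : ContinuousAt f p :=
  h.contDiffAt.continuousAt

lemma SmoothNear.eventually_contDiffAt_two {f : E → F} {p : E} (h : SmoothNear f p) :
    ∀ᶠ q in 𝓝 p, ContDiffAt ℝ 2 f q :=
  h.mono fun _ hq => hq.of_le (WithTop.coe_le_coe.mpr le_top)

lemma smoothNear_const (c : F) (p : E) : SmoothNear (fun _ => c) p :=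
  Eventually.of_forall fun _ => contDiffAt_const

lemma SmoothNear.add {f g : E → F} {p : E} (hf : SmoothNear f p) (hg : SmoothNear g p) :
    SmoothNear (fun q => f q + g q) p := by
  filter_upwards [hf, hg] with q h1 h2 using h1.add h2

lemma SmoothNear.sub {f g : E → F} {p : E} (hf : SmoothNear f p) (hg : SmoothNear g p) :
    SmoothNear (fun q => f q - g q) p := by
  filter_upwards [hf, hg] with q h1 h2 using h1.sub h2

lemma SmoothNear.neg {f : E → F} {p : E} (hf : SmoothNear f p) :
    SmoothNear (fun q => -f q) p := by
  filter_upwards [hf] with q h1 using h1.neg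

lemma SmoothNear.sum {ι : Type*} {S : Finset ι} {f : ι → E → F} {p : E}
    (hf : ∀ i ∈ S, SmoothNear (f i) p) : SmoothNear (fun q => ∑ i ∈ S, f i q) p := by
  have := (S.eventually_all (l := 𝓝 p) (p := fun i q => ContDiffAt ℝ ∞ (f i) q)).mpr hf
  filter_upwards [this] with q hq using ContDiffAt.sum hq

lemma SmoothNear.mul {f g : E → ℂ} {p : E} (hf : SmoothNear f p) (hg : SmoothNear g p) :
    SmoothNear (fun q => f q * g q) p := by
  filter_upwards [hf, hg] with q h1 h2 using h1.mul h2

lemma SmoothNear.div {f g : E → ℂ} {p : E} (hf : SmoothNear f p) (hg : SmoothNear g p)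
    (h0 : g p ≠ 0) : SmoothNear (fun q => f q / g q) p := by
  filter_upwards [hf, hg, hg.continuousAt.eventually_ne h0] with q h1 h2 h3
  simp only [div_eq_mul_inv]
  exact h1.mul (h2.inv h3)

lemma SmoothNear.conj {f : E → ℂ} {p : E} (hf : SmoothNear f p) :
    SmoothNear (fun q => conj (f q)) p := by
  filter_upwards [hf] with q h1
  exact Complex.conjCLE.contDiff.contDiffAt.comp q h1

lemma SmoothNear.smul {G : Type*} [NormedAddCommGroup G] [NormedSpace ℂ G] {f : E → ℂ} {g : E → G}
    {p : E} (hf : SmoothNear f p) (hg : SmoothNear g p) : SmoothNear (fun q => f q • g q) p := by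
  filter_upwards [hf, hg] with q h1 h2 using h1.smul h2

lemma SmoothNear.comp {G : Type*} [NormedAddCommGroup G] [NormedSpace ℝ G] {g : F → G} {f : E → F}
    {p : E} (hg : SmoothNear g (f p)) (hf : SmoothNear f p) : SmoothNear (fun q => g (f q)) p := by
  filter_upwards [hf, hf.continuousAt.eventually hg] with q h1 h2 using h2.comp q h1

lemma SmoothNear.fderiv_apply {f : E → F} {X : E → E} {p : E} (hf : SmoothNear f p)
    (hX : SmoothNear X p) : SmoothNear (fun q => fderiv ℝ f q (X q)) p := by
  filter_upwards [hf, hX] with q h1 h2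
  exact (h1.fderiv_right (m := ∞) (by simp)).clm_apply h2

lemma SmoothNear.fderiv_fderiv_apply {f : E → F} {X Y : E → E} {p : E} (hf : SmoothNear f p)
    (hX : SmoothNear X p) (hY : SmoothNear Y p) :
    SmoothNear (fun q => fderiv ℝ (fderiv ℝ f) q (X q) (Y q)) p := by
  filter_upwards [hf, hX, hY] with q h1 h2 h3
  exact (((h1.fderiv_right (m := ∞) (by simp)).fderiv_right (m := ∞) (by simp)).clm_apply
    h2).clm_apply h3

lemma SmoothNear.ofReal {f : E → ℝ} {p : E} (hf : SmoothNear f p) :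
    SmoothNear (fun q => (f q : ℂ)) p := by
  filter_upwards [hf] with q h1
  exact Complex.ofRealCLM.contDiff.contDiffAt.comp q h1

lemma SmoothNear.congr {f g : E → F} {p : E} (hf : SmoothNear f p) (h : ∀ᶠ q in 𝓝 p, g q = f q) :
    SmoothNear g p := by
  filter_upwards [hf, h.eventually_nhds] with q h1 h2 using h1.congr_of_eventuallyEq h2

end SmoothNear

section SmoothNearComplex

variable {E : Type*} [NormedAddCommGroup E] [NormedSpace ℂ E]

lemma SmoothNear.del {f : E → ℝ} {X : E → E} {p : E} (hf : SmoothNear f p) (hX : SmoothNear X p) :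
    SmoothNear (fun q => del (fun x => (f x : ℂ)) q (X q)) p := by
  have hIX : SmoothNear (fun q => Complex.I • X q) p := (smoothNear_const Complex.I p).smul hX
  refine SmoothNear.congr (((hf.fderiv_apply hX).ofReal.sub ((smoothNear_const Complex.I p).mul
    (hf.fderiv_apply hIX).ofReal)).div (smoothNear_const (2 : ℂ) p) two_ne_zero) ?_
  filter_upwards [hf] with q hq
  exact del_ofReal_apply (hq.differentiableAt (by simp)) _

lemma SmoothNear.complexHessian {f : E → ℝ} {X Y : E → E} {p : E} (hf : SmoothNear f p)
    (hX : SmoothNear X p) (hY : SmoothNear Y p) :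
    SmoothNear (fun q => complexHessian f q (X q) (Y q)) p := by
  have hI := smoothNear_const (E := E) Complex.I p
  refine SmoothNear.congr ((((hf.fderiv_fderiv_apply hX hY).ofReal.add
    (hf.fderiv_fderiv_apply (hI.smul hX) (hI.smul hY)).ofReal).add
    (hI.mul ((hf.fderiv_fderiv_apply hX (hI.smul hY)).ofReal.sub
    (hf.fderiv_fderiv_apply (hI.smul hX) hY).ofReal))).div (smoothNear_const (4 : ℂ) p)
    (by norm_num)) ?_
  filter_upwards [hf.eventually_contDiffAt_two] with q hq
  exact complexHessian_eq hq _ _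

end SmoothNearComplex

end Hartogs

namespace Hartogs

open ComplexConjugate

/-! ### Orthogonal frames for the complex Hessian and diagonalization of the Levi form. -/

section Frames

variable {E : Type*} [NormedAddCommGroup E] [NormedSpace ℂ E]

/-- The complex Hessian has an orthogonal basis on every finite-dimensional subspace. -/
lemma exists_complexHessian_orthogonal_basis {r : E → ℝ} {p : E} (hr : ContDiffAt ℝ 2 r p)
    (T : Submodule ℂ E) [FiniteDimensional ℂ T] :
    ∃ v : Module.Basis (Fin (Module.finrank ℂ T)) ℂ T,
      ∀ i j, i ≠ j → complexHessian r p (v i) (v j) = 0 := by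
  let b := Module.finBasis ℂ T
  -- The indices are transposed because the Hessian is conjugate-linear in its second argument: this
  -- makes `star u ⬝ᵥ A.mulVec v` the Hessian of the vectors with coordinates `v` and `u`, in that
  -- order.
  let A : Matrix (Fin (Module.finrank ℂ T)) (Fin (Module.finrank ℂ T)) ℂ :=
    Matrix.of fun j i => complexHessian r p (b i) (b j)
  have hA : A.IsHermitian := by
    ext i j
    simp only [A, Matrix.conjTranspose_apply, Matrix.of_apply]
    exact (complexHessian_swap hr _ _).symm
  let v := hA.eigenvectorBasis.toBasis.map ((WithLp.linearEquiv 2 ℂ _).trans b.equivFun.symm)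
  have hv : ∀ k, ((v k : T) : E) = ∑ i, hA.eigenvectorBasis k i • (b i : E) := by
    intro k
    simp [v, Module.Basis.equivFun_symm_apply]
  refine ⟨v, fun k l hkl => ?_⟩
  have h1 : complexHessian r p (v k) (v l)
      = star (hA.eigenvectorBasis l : Fin (Module.finrank ℂ T) → ℂ)
        ⬝ᵥ (A.mulVec (hA.eigenvectorBasis k)) := by
    rw [hv, hv, complexHessian_sum_right hr]
    refine Finset.sum_congr rfl fun j _ => ?_
    rw [complexHessian_smul_right hr, complexHessian_sum_left, Matrix.mulVec, dotProduct]
    congr 1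
    refine Finset.sum_congr rfl fun i _ => ?_
    rw [complexHessian_smul_left, mul_comm]
    rfl
  rw [h1, hA.mulVec_eigenvectorBasis, dotProduct_smul]
  have h2 : inner ℂ (hA.eigenvectorBasis l) (hA.eigenvectorBasis k) = 0 :=
    hA.eigenvectorBasis.orthonormal.2 hkl.symm
  rw [EuclideanSpace.inner_eq_star_dotProduct, dotProduct_comm] at h2
  rw [h2, smul_zero]

/-- An orthogonal basis of `T` has at most one null vector if the radical of the complex Hessian
on `T` is at most a line. -/
lemma exists_orthogonal_basis_null_unique {r : E → ℝ} {p : E} (hr : ContDiffAt ℝ 2 r p)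
    (T : Submodule ℂ E) [FiniteDimensional ℂ T]
    (hT : ∀ x ∈ T, ∀ y ∈ T, (∀ t ∈ T, complexHessian r p x t = 0) →
      (∀ t ∈ T, complexHessian r p y t = 0) → ¬ LinearIndependent ℂ ![x, y]) :
    ∃ v : Module.Basis (Fin (Module.finrank ℂ T)) ℂ T,
      (∀ i j, i ≠ j → complexHessian r p (v i) (v j) = 0) ∧
      ∀ i j, i ≠ j → complexHessian r p (v i) (v i) ≠ 0 ∨ complexHessian r p (v j) (v j) ≠ 0 := by
  obtain ⟨v, hv⟩ := exists_complexHessian_orthogonal_basis hr T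
  refine ⟨v, hv, fun i j hij => ?_⟩
  by_contra! h
  -- A null vector of an orthogonal basis is orthogonal to every basis vector, itself included, so
  -- it lies in the radical.
  have hrad : ∀ i, complexHessian r p (v i) (v i) = 0 →
      ∀ t ∈ T, complexHessian r p (v i) t = 0 := by
    intro i hi t ht
    have ht' : t = ∑ k, v.repr ⟨t, ht⟩ k • ((v k : T) : E) := by
      have h := congrArg T.subtype (v.sum_repr ⟨t, ht⟩)
      rw [map_sum] at h
      simpa only [map_smul, Submodule.subtype_apply] using h.symm
    rw [ht', complexHessian_sum_right hr]
    refine Finset.sum_eq_zero fun k _ => ?_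
    rw [complexHessian_smul_right hr]
    rcases eq_or_ne i k with rfl | hk
    · rw [hi, mul_zero]
    · rw [hv i k hk, mul_zero]
  refine hT (v i) (v i).2 (v j) (v j).2 (hrad i h.1) (hrad j h.2) ?_
  have hli : LinearIndependent ℂ (fun k => ((v k : T) : E)) :=
    v.linearIndependent.map' T.subtype T.ker_subtype
  have := hli.comp ![i, j] (by
    intro a b hab
    fin_cases a <;> fin_cases b <;> simp_all [eq_comm])
  convert this using 1
  ext k
  fin_cases k <;> rfl

/-- Gram–Schmidt with smooth coefficients: an orthogonal system of tangent vectors at `p` extends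
to smooth tangent fields, such that the fields extending the non-null vectors indexed by `N` are
orthogonal to all others and to a transversal field `ν`. -/
lemma exists_smooth_orthogonal_fields {ι : Type*} {r : E → ℝ} {p : E} (hr : SmoothNear r p)
    (W : Submodule ℂ E) (v : ι → E) (hvW : ∀ i, v i ∈ W)
    (hv : ∀ i, del (fun x => (r x : ℂ)) p (v i) = 0)
    (horth : ∀ i j, i ≠ j → complexHessian r p (v i) (v j) = 0)
    {n : E} (hnW : n ∈ W) (hn : del (fun x => (r x : ℂ)) p n ≠ 0)
    (N : Finset ι) (hN : ∀ i ∈ N, complexHessian r p (v i) (v i) ≠ 0) :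
    ∃ (Z : ι → E → E) (ν : E → E), (∀ i, SmoothNear (Z i) p) ∧ SmoothNear ν p ∧
      (∀ i, Z i p = v i) ∧ (∀ i q, Z i q ∈ W) ∧ (∀ q, ν q ∈ W) ∧
      (∀ᶠ q in 𝓝 p, del (fun x => (r x : ℂ)) q (ν q) = 1) ∧
      (∀ i, ∀ᶠ q in 𝓝 p, del (fun x => (r x : ℂ)) q (Z i q) = 0) ∧
      ∀ i ∈ N, (∀ᶠ q in 𝓝 p, complexHessian r q (ν q) (Z i q) = 0) ∧
        ∀ j, j ≠ i → ∀ᶠ q in 𝓝 p, complexHessian r q (Z j q) (Z i q) = 0 := by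
  classical
  induction N using Finset.induction_on with
  | empty =>
    -- Without pivots, `n` is scaled to `∂r(ν) = 1` and each constant `v i` is made tangent by
    -- subtracting `∂r(v i) • ν`, which vanishes at `p`.
    have hθn : SmoothNear (fun q => del (fun x => (r x : ℂ)) q n) p :=
      hr.del (smoothNear_const n p)
    have hne := hθn.continuousAt.eventually_ne hn
    have hν : SmoothNear (fun q => (1 / del (fun x => (r x : ℂ)) q n) • n) p :=
      ((smoothNear_const 1 p).div hθn hn).smul (smoothNear_const n p)
    refine ⟨fun i q => v i - del (fun x => (r x : ℂ)) q (v i) •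
      ((1 / del (fun x => (r x : ℂ)) q n) • n), fun q => (1 / del (fun x => (r x : ℂ)) q n) • n,
      fun i => (smoothNear_const (v i) p).sub ((hr.del (smoothNear_const (v i) p)).smul hν), hν,
      fun i => ?_, fun i q => W.sub_mem (hvW i) (W.smul_mem _ (W.smul_mem _ hnW)),
      fun q => W.smul_mem _ hnW, ?_, fun i => ?_, by simp⟩
    · simp [hv]
    · filter_upwards [hne] with q hq
      rw [map_smul, smul_eq_mul, one_div_mul_cancel hq]
    · filter_upwards [hne] with q hq
      rw [map_sub, map_smul, map_smul, smul_eq_mul, smul_eq_mul, one_div_mul_cancel hq, mul_one,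
        sub_self]
  | insert a N ha ih =>
    obtain ⟨Z, ν, hZs, hνs, hZp, hZW, hνW, hν1, hZ0, hZN⟩ :=
      ih fun i hi => hN i (Finset.mem_insert_of_mem hi)
    have haa : complexHessian r p (Z a p) (Z a p) ≠ 0 := by
      rw [hZp]
      exact hN a (Finset.mem_insert_self a N)
    have hD : SmoothNear (fun q => complexHessian r q (Z a q) (Z a q)) p :=
      hr.complexHessian (hZs a) (hZs a)
    have hDne := hD.continuousAt.eventually_ne haa
    -- Projection along the new pivot `Z a`; the quotient is smooth since `Z a` is not null at `p`.
    -- It fixes the earlier pivots near `p`, being already orthogonal to `Z a`, and it fixes the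
    -- other `Z j` at `p`, where the `v j` are orthogonal.
    let P : (E → E) → E → E := fun Y q =>
      Y q - (complexHessian r q (Y q) (Z a q) / complexHessian r q (Z a q) (Z a q)) • Z a q
    have hPs : ∀ Y, SmoothNear Y p → SmoothNear (P Y) p := fun Y hY =>
      hY.sub (((hr.complexHessian hY (hZs a)).div hD haa).smul (hZs a))
    have hPW : ∀ Y : E → E, (∀ q, Y q ∈ W) → ∀ q, P Y q ∈ W := fun Y hY q =>
      W.sub_mem (hY q) (W.smul_mem _ (hZW a q))
    have hPθ : ∀ Y : E → E, ∀ᶠ q in 𝓝 p,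
        del (fun x => (r x : ℂ)) q (P Y q) = del (fun x => (r x : ℂ)) q (Y q) := fun Y => by
      filter_upwards [hZ0 a] with q hq
      simp only [P, map_sub, map_smul, hq, smul_zero, sub_zero]
    have hPa : ∀ Y : E → E, ∀ᶠ q in 𝓝 p, complexHessian r q (P Y q) (Z a q) = 0 := fun Y => by
      filter_upwards [hDne] with q hq
      simp only [P, complexHessian_sub_left, complexHessian_smul_left]
      rw [div_mul_cancel₀ _ hq, sub_self]
    have hPN : ∀ i ∈ N, ∀ᶠ q in 𝓝 p, P (Z i) q = Z i q := by
      intro i hi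
      have hai : a ≠ i := fun h => ha (h ▸ hi)
      filter_upwards [(hZN i hi).2 a hai, hr.eventually_contDiffAt_two] with q hq hq2
      simp only [P]
      rw [complexHessian_swap hq2, hq, map_zero, zero_div, zero_smul, sub_zero]
    have hPNY : ∀ i ∈ N, ∀ Y : E → E, (∀ᶠ q in 𝓝 p, complexHessian r q (Y q) (Z i q) = 0) →
        ∀ᶠ q in 𝓝 p, complexHessian r q (P Y q) (Z i q) = 0 := by
      intro i hi Y hY
      have hai : a ≠ i := fun h => ha (h ▸ hi)
      filter_upwards [(hZN i hi).2 a hai, hY] with q h1 h2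
      simp only [P, complexHessian_sub_left, complexHessian_smul_left, h1, h2, mul_zero, sub_zero]
    refine ⟨fun j => if j = a then Z a else P (Z j), P ν, fun j => ?_, hPs ν hνs, fun j => ?_,
      fun j => ?_, hPW ν hνW, ?_, fun j => ?_, fun i hi => ⟨?_, fun j hj => ?_⟩⟩
    · dsimp only
      split_ifs
      exacts [hZs a, hPs _ (hZs j)]
    · dsimp only
      split_ifs with hja
      · rw [hja, hZp]
      · simp only [P]
        rw [hZp, hZp, horth j a hja, zero_div, zero_smul, sub_zero]
    · dsimp only
      split_ifs
      exacts [hZW a, hPW _ (hZW j)]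
    · filter_upwards [hPθ ν, hν1] with q h1 h2 using h1.trans h2
    · dsimp only
      split_ifs
      · exact hZ0 a
      · filter_upwards [hPθ (Z j), hZ0 j] with q h1 h2 using h1.trans h2
    · dsimp only
      split_ifs with hia
      · exact hPa ν
      · have hiN : i ∈ N := (Finset.mem_insert.mp hi).resolve_left hia
        filter_upwards [hPN i hiN, hPNY i hiN ν (hZN i hiN).1] with q h1 h2
        rw [h1, h2]
    · dsimp only
      by_cases hia : i = a
      · subst hia
        rw [if_pos rfl, if_neg hj]
        exact hPa (Z j)
      · have hiN : i ∈ N := (Finset.mem_insert.mp hi).resolve_left hia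
        rw [if_neg hia]
        split_ifs with hja
        · subst hja
          filter_upwards [hPN i hiN, (hZN i hiN).2 j hj] with q h1 h2
          rw [h1, h2]
        · filter_upwards [hPN i hiN, hPNY i hiN (Z j) ((hZN i hiN).2 j hj)] with q h1 h2
          rw [h1, h2]

/-- Smooth fields `Z j` and a transversal field `ν` near `p`, orthogonal except that one `Z j` may
fail to be orthogonal to `ν`. The fields indexed by `R` are not yet tangent, but their
deviation from tangency is controlled by their length. -/
structure IsPartialFrame {J : Type*} (r : E → ℝ) (p : E) (R : Finset J) (Z : J → E → E)
    (ν : E → E) : Prop where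
  smooth : ∀ j, SmoothNear (Z j) p
  smooth_normal : SmoothNear ν p
  normal : ∀ᶠ q in 𝓝 p, del (fun x => (r x : ℂ)) q (ν q) = 1
  tangent : ∀ j, j ∉ R → ∀ᶠ q in 𝓝 p, del (fun x => (r x : ℂ)) q (Z j q) = 0
  orthogonal : ∀ i j, i ≠ j → ∀ᶠ q in 𝓝 p, complexHessian r q (Z i q) (Z j q) = 0
  mul_eq_zero : ∀ i j, i ≠ j → ∀ᶠ q in 𝓝 p,
    complexHessian r q (Z i q) (ν q) * conj (complexHessian r q (Z j q) (ν q)) = 0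
  orthogonal_normal : ∀ j ∈ R, ∀ᶠ q in 𝓝 p, complexHessian r q (Z j q) (ν q) = 0
  exists_factor : ∀ j ∈ R, ∃ α : E → ℂ, SmoothNear α p ∧ α p = 0 ∧ ∀ᶠ q in 𝓝 p,
    del (fun x => (r x : ℂ)) q (Z j q) = α q * complexHessian r q (Z j q) (Z j q)

/-- Replaces `Z i` by the tangent field `X` and projects the other fields, and `ν`, along `X`. The
factorization `∂r(Z i) = α l` is what keeps this projection smooth where `l` vanishes. -/
lemma IsPartialFrame.exists_erase {J : Type*} [DecidableEq J] {r : E → ℝ} {p : E}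
    (hr : SmoothNear r p) {R : Finset J} {i : J} (hi : i ∉ R) {Z : J → E → E} {ν : E → E}
    (h : IsPartialFrame r p (insert i R) Z ν) :
    ∃ Z' ν', IsPartialFrame r p R Z' ν' ∧ ∀ j, Z' j p = Z j p := by
  obtain ⟨α, hαs, hαp, hα⟩ := h.exists_factor i (Finset.mem_insert_self i R)
  have hiν := h.orthogonal_normal i (Finset.mem_insert_self i R)
  let l : E → ℂ := fun q => complexHessian r q (Z i q) (Z i q)
  let κ : E → ℂ := fun q => complexHessian r q (ν q) (ν q)
  let D : E → ℂ := fun q => 1 + α q * conj (α q) * l q * κ q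
  let X : E → E := fun q => Z i q - (α q * l q) • ν q
  -- For `Y` orthogonal to `Z i`, the coefficient is `H(Y, X) / H(X, X)` after cancelling `l`: the
  -- numerator is `-conj α * l * H(Y, ν)` and the denominator `l * D`, with `D p = 1`.
  let P : (E → E) → E → E := fun Y q =>
    Y q - (-conj (α q) * complexHessian r q (Y q) (ν q) / D q) • X q
  have hls : SmoothNear l p := hr.complexHessian (h.smooth i) (h.smooth i)
  have hκs : SmoothNear κ p := hr.complexHessian h.smooth_normal h.smooth_normal
  have hDs : SmoothNear D p :=
    (smoothNear_const 1 p).add (((hαs.mul hαs.conj).mul hls).mul hκs)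
  have hDp : D p ≠ 0 := by simp [D, hαp]
  have hDne := hDs.continuousAt.eventually_ne hDp
  have hXs : SmoothNear X p := (h.smooth i).sub ((hαs.mul hls).smul h.smooth_normal)
  have hXp : X p = Z i p := by simp [X, hαp]
  have hPs : ∀ Y, SmoothNear Y p → SmoothNear (P Y) p := fun Y hY =>
    hY.sub (((hαs.conj.neg.mul (hr.complexHessian hY h.smooth_normal)).div hDs hDp).smul hXs)
  have hPp : ∀ Y, P Y p = Y p := fun Y => by simp [P, hαp]
  have hXθ : ∀ᶠ q in 𝓝 p, del (fun x => (r x : ℂ)) q (X q) = 0 := by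
    filter_upwards [hα, h.normal] with q h1 h2
    simp only [X, l, map_sub, map_smul, h1, h2, smul_eq_mul, mul_one, sub_self]
  have hPθ : ∀ Y : E → E, ∀ᶠ q in 𝓝 p,
      del (fun x => (r x : ℂ)) q (P Y q) = del (fun x => (r x : ℂ)) q (Y q) := fun Y => by
    filter_upwards [hXθ] with q hq
    simp only [P, map_sub, map_smul, hq, smul_zero, sub_zero]
  have hr2 := hr.eventually_contDiffAt_two
  have hYX : ∀ Y : E → E, (∀ᶠ q in 𝓝 p, complexHessian r q (Y q) (Z i q) = 0) → ∀ᶠ q in 𝓝 p,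
      complexHessian r q (Y q) (X q) = -conj (α q) * l q * complexHessian r q (Y q) (ν q) := by
    intro Y hY
    filter_upwards [hY, hr2] with q h1 h2
    have hl : conj (l q) = l q := (complexHessian_swap h2 _ _).symm
    simp only [X, complexHessian_sub_right h2, complexHessian_smul_right h2, h1, map_mul, hl]
    ring
  have hνi : ∀ᶠ q in 𝓝 p, complexHessian r q (ν q) (Z i q) = 0 := by
    filter_upwards [hiν, hr2] with q h1 h2
    rw [complexHessian_swap h2, h1, map_zero]
  have hXX : ∀ᶠ q in 𝓝 p, complexHessian r q (X q) (X q) = l q * D q := by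
    filter_upwards [hYX ν hνi, hiν, hr2] with q h1 h2 h3
    have hl : conj (l q) = l q := (complexHessian_swap h3 _ _).symm
    conv_lhs => rw [show X q = Z i q - (α q * l q) • ν q from rfl]
    rw [complexHessian_sub_left, complexHessian_smul_left]
    rw [show Z i q - (α q * l q) • ν q = X q from rfl, h1]
    simp only [X, complexHessian_sub_right h3, complexHessian_smul_right h3, h2, D]
    simp only [l, κ]
    ring
  have hPX : ∀ Y : E → E, (∀ᶠ q in 𝓝 p, complexHessian r q (Y q) (Z i q) = 0) →
      ∀ᶠ q in 𝓝 p, complexHessian r q (P Y q) (X q) = 0 := by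
    intro Y hY
    filter_upwards [hYX Y hY, hXX, hDne] with q h1 h2 h3
    simp only [P, complexHessian_sub_left, complexHessian_smul_left, h1, h2]
    field_simp
    ring
  -- The projection perturbs the form by a rank-one term in `H(·, ν)`; `mul_eq_zero` kills it for
  -- two distinct fields of the frame.
  have hPP : ∀ Y Y' : E → E, (∀ᶠ q in 𝓝 p, complexHessian r q (Y q) (Z i q) = 0) →
      (∀ᶠ q in 𝓝 p, complexHessian r q (Y' q) (Z i q) = 0) →
      ∀ᶠ q in 𝓝 p, ∃ a, complexHessian r q (P Y q) (P Y' q) = complexHessian r q (Y q) (Y' q)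
        + a * (complexHessian r q (Y q) (ν q) * conj (complexHessian r q (Y' q) (ν q))) := by
    intro Y Y' hY hY'
    filter_upwards [hPX Y hY, hYX Y' hY', hr2] with q h1 h2 h3
    have h4 : complexHessian r q (P Y q) (P Y' q) = complexHessian r q (P Y q) (Y' q) := by
      conv_lhs => rw [show P Y' q = Y' q
        - (-conj (α q) * complexHessian r q (Y' q) (ν q) / D q) • X q from rfl]
      rw [complexHessian_sub_right h3, complexHessian_smul_right h3, h1, mul_zero, sub_zero]
    rw [h4]
    simp only [P, complexHessian_sub_left, complexHessian_smul_left]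
    rw [complexHessian_swap h3 (Y' q) (X q), h2, map_mul]
    exact ⟨conj (α q) / D q * conj (-conj (α q) * l q), by ring⟩
  -- Fields still to be treated are orthogonal to `ν`, so `P` fixes them and their own factorization
  -- survives.
  have hPR : ∀ j ∈ R, ∀ᶠ q in 𝓝 p, P (Z j) q = Z j q := by
    intro j hj
    filter_upwards [h.orthogonal_normal j (Finset.mem_insert_of_mem hj)] with q hq
    simp [P, hq]
  have hPν : ∀ j, j ≠ i → ∀ᶠ q in 𝓝 p, ∃ a,
      complexHessian r q (P (Z j) q) (P ν q) = a * complexHessian r q (Z j q) (ν q) := by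
    intro j hj
    filter_upwards [hPP (Z j) ν (h.orthogonal j i hj) hνi] with q ⟨a, ha⟩
    exact ⟨1 + a * conj (complexHessian r q (ν q) (ν q)), by rw [ha]; ring⟩
  have hXν : ∀ᶠ q in 𝓝 p, complexHessian r q (X q) (P ν q) = 0 := by
    filter_upwards [hPX ν hνi, hr2] with q h1 h2
    rw [complexHessian_swap h2, h1, map_zero]
  have hZX : ∀ j, j ≠ i → ∀ᶠ q in 𝓝 p, complexHessian r q (P (Z j) q) (X q) = 0 := fun j hj =>
    hPX (Z j) (h.orthogonal j i hj)
  have hne : ∀ j ∈ R, j ≠ i := fun j hj hji => hi (hji ▸ hj)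
  refine ⟨fun j => if j = i then X else P (Z j), P ν, ⟨fun j => ?_, hPs _ h.smooth_normal, ?_,
    fun j hj => ?_, fun j k hjk => ?_, fun j k hjk => ?_, fun j hj => ?_, fun j hj => ?_⟩,
    fun j => ?_⟩
  · split_ifs
    exacts [hXs, hPs _ (h.smooth j)]
  · filter_upwards [hPθ ν, h.normal] with q h1 h2 using h1.trans h2
  · split_ifs with hji
    · exact hXθ
    · filter_upwards [hPθ (Z j), h.tangent j (by simp [hji, hj])] with q h1 h2 using h1.trans h2
  · by_cases hji : j = i
    · have hki : k ≠ i := fun hk => hjk (hji.trans hk.symm)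
      rw [if_pos hji, if_neg hki]
      filter_upwards [hZX k hki, hr2] with q h1 h2
      rw [complexHessian_swap h2, h1, map_zero]
    · rw [if_neg hji]
      by_cases hki : k = i
      · rw [if_pos hki]
        exact hZX j hji
      · rw [if_neg hki]
        filter_upwards [hPP (Z j) (Z k) (h.orthogonal j i hji) (h.orthogonal k i hki),
          h.orthogonal j k hjk, h.mul_eq_zero j k hjk] with q ⟨a, ha⟩ h1 h2
        rw [ha, h1, h2, mul_zero, add_zero]
  · by_cases hji : j = i
    · rw [if_pos hji]
      filter_upwards [hXν] with q h1
      rw [h1, zero_mul]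
    · rw [if_neg hji]
      by_cases hki : k = i
      · rw [if_pos hki]
        filter_upwards [hXν] with q h1
        rw [h1, map_zero, mul_zero]
      · rw [if_neg hki]
        filter_upwards [hPν j hji, hPν k hki, h.mul_eq_zero j k hjk] with q ⟨a, ha⟩ ⟨b, hb⟩ h1
        rw [ha, hb, map_mul]
        linear_combination a * conj b * h1
  · rw [if_neg (hne j hj)]
    filter_upwards [hPν j (hne j hj), h.orthogonal_normal j (Finset.mem_insert_of_mem hj)]
      with q ⟨a, ha⟩ h1
    rw [ha, h1, mul_zero]
  · rw [if_neg (hne j hj)]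
    obtain ⟨β, hβs, hβp, hβ⟩ := h.exists_factor j (Finset.mem_insert_of_mem hj)
    refine ⟨β, hβs, hβp, ?_⟩
    filter_upwards [hPR j hj, hβ] with q h1 h2
    rw [h1, h2]
  · dsimp only
    split_ifs with hji
    · rw [hXp, hji]
    · exact hPp _

lemma IsPartialFrame.exists_tangent {J : Type*} {r : E → ℝ} {p : E} (hr : SmoothNear r p)
    {R : Finset J} {Z : J → E → E} {ν : E → E} (h : IsPartialFrame r p R Z ν) :
    ∃ Z' ν', IsPartialFrame r p ∅ Z' ν' ∧ ∀ j, Z' j p = Z j p := by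
  classical
  induction R using Finset.induction_on generalizing Z ν with
  | empty => exact ⟨Z, ν, h, fun _ => rfl⟩
  | insert i R hi ih =>
    obtain ⟨Z₁, ν₁, h₁, hp₁⟩ := h.exists_erase hr hi
    obtain ⟨Z₂, ν₂, h₂, hp₂⟩ := ih h₁
    exact ⟨Z₂, ν₂, h₂, fun j => (hp₂ j).trans (hp₁ j)⟩

lemma finrank_complexTangent [FiniteDimensional ℂ E] {r : E → ℝ} {q : E}
    (hq : del (fun x => (r x : ℂ)) q ≠ 0) :
    Module.finrank ℂ (complexTangent r q) = Module.finrank ℂ E - 1 := by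
  have h1 := LinearMap.finrank_range_add_finrank_ker (del (fun x => (r x : ℂ)) q)
  have h2 : LinearMap.range (del (fun x => (r x : ℂ)) q) = ⊤ :=
    LinearMap.range_eq_top.mpr (LinearMap.surjective hq)
  rw [h2, finrank_top, Module.finrank_self] at h1
  rw [← h1, Nat.add_sub_cancel_left]
  rfl

/-- The values at `p` of a tangent frame form a basis of the complex tangent space; then
the Levi form is locally diagonalizable. -/
lemma IsPartialFrame.hasLocallyDiagonalizableLeviFormAt [FiniteDimensional ℂ E] {J : Type*}
    [Fintype J] {r : E → ℝ} {p : E} (hr : SmoothNear r p) {Z : J → E → E} {ν : E → E}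
    (h : IsPartialFrame r p ∅ Z ν) (hli : LinearIndependent ℂ fun j => Z j p)
    (hspan : complexTangent r p ≤ Submodule.span ℂ (Set.range fun j => Z j p)) {D : Set E}
    (hD : ∀ᶠ q in 𝓝 p, q ∈ D ↔ r q < 0) : HasLocallyDiagonalizableLeviFormAt D r p := by
  have hθ : ∀ᶠ q in 𝓝 p, del (fun x => (r x : ℂ)) q ≠ 0 := by
    filter_upwards [h.normal] with q hq h0
    simp [h0] at hq
  have htan : ∀ᶠ q in 𝓝 p, ∀ j, del (fun x => (r x : ℂ)) q (Z j q) = 0 :=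
    eventually_all.mpr fun j => h.tangent j (by simp)
  have hcard : Fintype.card J = Module.finrank ℂ E - 1 := by
    have hs : Submodule.span ℂ (Set.range fun j => Z j p) = complexTangent r p := by
      refine le_antisymm (Submodule.span_le.mpr ?_) hspan
      rintro _ ⟨j, rfl⟩
      exact htan.self_of_nhds j
    rw [← finrank_complexTangent hθ.self_of_nhds, ← hs, finrank_span_eq_card hli]
  have horth : ∀ᶠ q in 𝓝 p, ∀ i j, i ≠ j → complexHessian r q (Z i q) (Z j q) = 0 := by
    refine eventually_all.mpr fun i => eventually_all.mpr fun j => ?_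
    by_cases hij : i = j
    · exact Eventually.of_forall fun q h => absurd hij h
    · exact (h.orthogonal i j hij).mono fun q hq _ => hq
  have hind : ∀ᶠ q in 𝓝 p, LinearIndependent ℂ fun j => Z j q := by
    have hc : ContinuousAt (fun q j => Z j q) p :=
      continuousAt_pi.mpr fun j => (h.smooth j).continuousAt
    exact hc.eventually (isOpen_setOfPred_linearIndependent.mem_nhds hli)
  have hsm : ∀ᶠ q in 𝓝 p, ∀ j, ContDiffAt ℝ ∞ (Z j) q := eventually_all.mpr h.smooth
  obtain ⟨V, hV, hVo, hpV⟩ := _root_.mem_nhds_iff.mp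
    (hr.and (hD.and (hθ.and (htan.and (horth.and (hind.and hsm))))))
  let e : Fin (Module.finrank ℂ E - 1) ≃ J := (finCongr hcard.symm).trans (Fintype.equivFin J).symm
  refine ⟨V, hVo, hpV, fun q hq => (hV hq).1.contDiffWithinAt, ?_, fun q hq h0 => ?_,
    fun j => Z (e j), fun j q hq => ((hV hq).2.2.2.2.2.2 (e j)).contDiffWithinAt,
    fun q hq => ⟨(hV hq).2.2.2.2.2.1.comp e e.injective, ?_⟩,
    fun q hq i j hij => (hV hq).2.2.2.2.1 _ _ (e.injective.ne hij)⟩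
  · ext q
    constructor
    · exact fun hq => ⟨hq.2, (hV hq.2).2.1.mp hq.1⟩
    · exact fun hq => ⟨(hV hq.1).2.1.mpr hq.2, hq.1⟩
  · exact (hV hq).2.2.1 ((del_ofReal_eq_zero_iff ((hV hq).1.differentiableAt (by simp))).mpr h0)
  · have hli' := (hV hq).2.2.2.2.2.1.comp e e.injective
    refine Submodule.eq_of_le_of_finrank_eq (Submodule.span_le.mpr ?_) ?_
    · rintro _ ⟨j, rfl⟩
      exact (hV hq).2.2.2.1 (e j)
    · rw [finrank_complexTangent (hV hq).2.2.1]
      exact (finrank_span_eq_card hli').trans (Fintype.card_fin _)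

/-- Diagonalization of the Levi form near a point `p` at which the space splits as `W ⊕ span e`,
where the Levi form is almost nondegenerate on `W` and the constant fields `e i` are orthogonal to
`W` and to each other, with `∂r (e i)` controlled by `⟨∂∂̄r; e i, e i⟩`. -/
theorem hasLocallyDiagonalizableLeviFormAt_of_decomposition [FiniteDimensional ℂ E] {I : Type*}
    [Fintype I] {r : E → ℝ} {p : E} (hr : SmoothNear r p) {D : Set E}
    (hD : ∀ᶠ q in 𝓝 p, q ∈ D ↔ r q < 0) (W : Submodule ℂ E) (e : I → E)
    (he : LinearIndependent ℂ e) (hWe : IsCompl W (Submodule.span ℂ (Set.range e)))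
    (heW : ∀ i, ∀ᶠ q in 𝓝 p, ∀ t ∈ W, complexHessian r q (e i) t = 0)
    (hee : ∀ i j, i ≠ j → ∀ᶠ q in 𝓝 p, complexHessian r q (e i) (e j) = 0)
    (hα : ∀ i, ∃ α : E → ℂ, SmoothNear α p ∧ α p = 0 ∧ ∀ᶠ q in 𝓝 p,
      del (fun x => (r x : ℂ)) q (e i) = α q * complexHessian r q (e i) (e i))
    {n : E} (hnW : n ∈ W) (hn : del (fun x => (r x : ℂ)) p n ≠ 0)
    (hrad : ∀ x ∈ W ⊓ complexTangent r p, ∀ y ∈ W ⊓ complexTangent r p,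
      (∀ t ∈ W ⊓ complexTangent r p, complexHessian r p x t = 0) →
      (∀ t ∈ W ⊓ complexTangent r p, complexHessian r p y t = 0) →
      ¬ LinearIndependent ℂ ![x, y]) :
    HasLocallyDiagonalizableLeviFormAt D r p := by
  classical
  have hr2 := hr.eventually_contDiffAt_two
  obtain ⟨v, hv, hvn⟩ := exists_orthogonal_basis_null_unique hr2.self_of_nhds
    (W ⊓ complexTangent r p) hrad
  -- The pivots: by `hvn` they are all indices except at most one.
  let N := Finset.univ.filter fun i => complexHessian r p (v i) (v i) ≠ 0
  obtain ⟨Z, ν, hZs, hνs, hZp, hZW, hνW, hν, hZθ, hZN⟩ := exists_smooth_orthogonal_fields hr W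
    (fun i => (v i : E)) (fun i => (v i).2.1) (fun i => (v i).2.2) hv hnW hn N (by simp [N])
  have hN : ∀ i j, i ≠ j → i ∈ N ∨ j ∈ N := by simpa [N] using hvn
  have hswap : ∀ X Y : E → E, (∀ᶠ q in 𝓝 p, complexHessian r q (X q) (Y q) = 0) →
      ∀ᶠ q in 𝓝 p, complexHessian r q (Y q) (X q) = 0 := by
    intro X Y h
    filter_upwards [h, hr2] with q h1 h2
    rw [complexHessian_swap h2, h1, map_zero]
  have heW' : ∀ i, ∀ Y : E → E, (∀ q, Y q ∈ W) →
      ∀ᶠ q in 𝓝 p, complexHessian r q (e i) (Y q) = 0 := fun i Y hY =>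
    (heW i).mono fun q hq => hq _ (hY q)
  let Z' : Fin (Module.finrank ℂ ↥(W ⊓ complexTangent r p)) ⊕ I → E → E :=
    Sum.elim Z fun i _ => e i
  have hZ' : IsPartialFrame r p (Finset.univ.map Function.Embedding.inr) Z' ν := by
    refine ⟨?_, hνs, hν, ?_, ?_, ?_, ?_, ?_⟩
    · rintro (j | i)
      exacts [hZs j, smoothNear_const _ _]
    · rintro (j | i) hj
      · exact hZθ j
      · simp at hj
    · rintro (j | i) (k | l) hjk
      · have hjk' : j ≠ k := fun h => hjk (h ▸ rfl)
        rcases hN j k hjk' with h | h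
        · exact hswap _ _ ((hZN j h).2 k hjk'.symm)
        · exact (hZN k h).2 j hjk'
      · exact hswap (fun _ => e l) _ (heW' l (Z j) (hZW j))
      · exact heW' i (Z k) (hZW k)
      · exact hee i l fun h => hjk (h ▸ rfl)
    · rintro (j | i) (k | l) hjk
      · have hjk' : j ≠ k := fun h => hjk (h ▸ rfl)
        rcases hN j k hjk' with h | h
        · filter_upwards [hswap _ _ (hZN j h).1] with q hq
          simp [Z', hq]
        · filter_upwards [hswap _ _ (hZN k h).1] with q hq
          simp [Z', hq]
      · filter_upwards [heW' l ν hνW] with q hq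
        simp [Z', hq]
      · filter_upwards [heW' i ν hνW] with q hq
        simp [Z', hq]
      · filter_upwards [heW' i ν hνW] with q hq
        simp [Z', hq]
    · rintro (j | i) hj
      · simp at hj
      · exact heW' i ν hνW
    · rintro (j | i) hj
      · simp at hj
      · exact hα i
  obtain ⟨Z₁, ν₁, h₁, hp₁⟩ := hZ'.exists_tangent hr
  have hvE : LinearIndependent ℂ fun j => (v j : E) :=
    v.linearIndependent.map' (W ⊓ complexTangent r p).subtype (Submodule.ker_subtype _)
  have hZ₁ : (fun j => Z₁ j p) = Sum.elim (fun j => (v j : E)) e := by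
    ext (j | i)
    · exact (hp₁ _).trans (hZp j)
    · exact hp₁ _
  have hvspan : Submodule.span ℂ (Set.range fun j => (v j : E)) = W ⊓ complexTangent r p := by
    have := congrArg (Submodule.map (W ⊓ complexTangent r p).subtype) v.span_eq
    rw [Submodule.map_span, ← Set.range_comp, Submodule.map_top, Submodule.range_subtype] at this
    exact this
  refine h₁.hasLocallyDiagonalizableLeviFormAt hr ?_ ?_ hD
  · rw [hZ₁]
    refine hvE.sum_type he ?_
    rw [hvspan]
    exact hWe.disjoint.mono_left inf_le_left
  · rw [hZ₁, Set.Sum.elim_range, Submodule.span_union, hvspan]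
    have hespan : Submodule.span ℂ (Set.range e) ≤ complexTangent r p := by
      refine Submodule.span_le.mpr ?_
      rintro _ ⟨i, rfl⟩
      obtain ⟨α, -, hαp, h⟩ := hα i
      have := h.self_of_nhds
      rwa [hαp, zero_mul] at this
    -- Modular law: the `e i` are tangent at `p` because `α p = 0`, so `(T ⊓ W) ⊔ span e = T ⊓ (W ⊔
    -- span e) = T`.
    rw [inf_comm, inf_sup_assoc_of_le _ hespan, hWe.sup_eq_top, inf_top_eq]

end Frames

end Hartogs

namespace Hartogs

open ComplexConjugate

/-! ### The summands of `h`. -/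

section OneVariable

lemma del_eq_mul_dw (g : ℂ → ℝ) (w t : ℂ) :
    del (fun x => (g x : ℂ)) w t = dw g w * t := by
  conv_lhs => rw [← mul_one t, ← smul_eq_mul, map_smul, smul_eq_mul, mul_comm]
  rfl

lemma complexHessian_eq_dwdwBar_mul {g : ℂ → ℝ} {w : ℂ} (hg : ContDiffAt ℝ 2 g w) (s t : ℂ) :
    complexHessian g w s t = dwdwBar g w * s * conj t := by
  conv_lhs => rw [← mul_one s, ← mul_one t, ← smul_eq_mul, ← smul_eq_mul]
  rw [complexHessian_smul_left, complexHessian_smul_right hg, dwdwBar]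
  ring

lemma IsAdmissibleSummand.contDiffAt_two {g : ℂ → ℝ} (hg : IsAdmissibleSummand g) (w : ℂ) :
    ContDiffAt ℝ 2 g w :=
  (hg.smooth.of_le (WithTop.coe_le_coe.mpr le_top)).contDiffAt

lemma IsAdmissibleSummand.dw_ne_zero {g : ℂ → ℝ} (hg : IsAdmissibleSummand g) {w : ℂ}
    (hw : w ≠ 0) : dw g w ≠ 0 := by
  intro h
  refine hg.grad_ne w hw ((del_ofReal_eq_zero_iff
    ((hg.contDiffAt_two w).differentiableAt (by simp))).mp ?_)
  ext
  simpa [dw] using h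

lemma IsAdmissibleSummand.dw_zero {g : ℂ → ℝ} (hg : IsAdmissibleSummand g) : dw g 0 = 0 := by
  have hmin : IsLocalMin g 0 := Eventually.of_forall fun w => by
    rw [(hg.eq_zero_iff 0).mpr rfl]
    exact hg.nonneg w
  have h := (del_ofReal_eq_zero_iff ((hg.contDiffAt_two 0).differentiableAt (by simp))).mpr
    hmin.fderiv_eq_zero
  rw [dw, h]
  rfl

/-- Log-subharmonicity cleared of its denominator; the origin is included because it is a minimum,
where the gradient vanishes. -/
lemma IsAdmissibleSummand.norm_dw_sq_le {g : ℂ → ℝ} (hg : IsAdmissibleSummand g) (w : ℂ) :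
    ‖dw g w‖ ^ 2 ≤ g w * (dwdwBar g w).re := by
  rcases eq_or_ne w 0 with rfl | hw
  · rw [hg.dw_zero]
    simpa using mul_nonneg (hg.nonneg 0) (hg.psh 0)
  · have hpos : 0 < g w := (hg.nonneg w).lt_of_ne fun h => hw ((hg.eq_zero_iff w).mp h.symm)
    have := hg.log_psh w hw
    rwa [div_le_iff₀ hpos, mul_comm] at this

end OneVariable

/-! ### Derivatives of sums with separated variables. -/

section Sums

variable {E F : Type*} [NormedAddCommGroup E] [NormedSpace ℂ E]
  [NormedAddCommGroup F] [NormedSpace ℂ F] {m : ℕ}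

lemma del_add_sum_comp {ρ : F → ℝ} {g : Fin m → ℂ → ℝ} {A : E →L[ℂ] F} {B : Fin m → E →L[ℂ] ℂ}
    {q : E} (hρ : ContDiffAt ℝ 2 ρ (A q)) (hg : ∀ i, IsAdmissibleSummand (g i)) (t : E) :
    del (fun x => ((ρ (A x) + ∑ i, g i (B i x) : ℝ) : ℂ)) q t
      = del (fun x => (ρ x : ℂ)) (A q) (A t) + ∑ i, dw (g i) (B i q) * B i t := by
  have hA : ContDiffAt ℝ 2 (fun x => ρ (A x)) q :=
    hρ.comp q (A.restrictScalars ℝ).contDiff.contDiffAt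
  have hB : ∀ i, ContDiffAt ℝ 2 (fun x => g i (B i x)) q := fun i =>
    ((hg i).contDiffAt_two _).comp q ((B i).restrictScalars ℝ).contDiff.contDiffAt
  rw [del_add (hA.differentiableAt (by simp))
    (DifferentiableAt.fun_sum fun i _ => (hB i).differentiableAt (by simp)),
    del_comp_clm (hρ.differentiableAt (by simp)),
    del_sum _ fun i _ => (hB i).differentiableAt (by simp)]
  congr 1
  refine Finset.sum_congr rfl fun i _ => ?_
  rw [del_comp_clm (((hg i).contDiffAt_two _).differentiableAt (by simp)), del_eq_mul_dw]

lemma complexHessian_add_sum_comp {ρ : F → ℝ} {g : Fin m → ℂ → ℝ} {A : E →L[ℂ] F}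
    {B : Fin m → E →L[ℂ] ℂ} {q : E} (hρ : ContDiffAt ℝ 2 ρ (A q))
    (hg : ∀ i, IsAdmissibleSummand (g i)) (s t : E) :
    complexHessian (fun x => ρ (A x) + ∑ i, g i (B i x)) q s t
      = complexHessian ρ (A q) (A s) (A t)
        + ∑ i, dwdwBar (g i) (B i q) * B i s * conj (B i t) := by
  have hA : ContDiffAt ℝ 2 (fun x => ρ (A x)) q :=
    hρ.comp q (A.restrictScalars ℝ).contDiff.contDiffAt
  have hB : ∀ i, ContDiffAt ℝ 2 (fun x => g i (B i x)) q := fun i =>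
    ((hg i).contDiffAt_two _).comp q ((B i).restrictScalars ℝ).contDiff.contDiffAt
  rw [complexHessian_add hA (ContDiffAt.sum fun i _ => hB i), complexHessian_comp_clm hρ,
    complexHessian_sum _ fun i _ => hB i]
  congr 1
  refine Finset.sum_congr rfl fun i _ => ?_
  rw [complexHessian_comp_clm ((hg i).contDiffAt_two _),
    complexHessian_eq_dwdwBar_mul ((hg i).contDiffAt_two _)]

lemma smoothNear_add_sum_comp {ρ : F → ℝ} {g : Fin m → ℂ → ℝ} {A : E →L[ℂ] F}
    {B : Fin m → E →L[ℂ] ℂ} {p : E} (hρ : SmoothNear ρ (A p))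
    (hg : ∀ i, IsAdmissibleSummand (g i)) :
    SmoothNear (fun x => ρ (A x) + ∑ i, g i (B i x)) p :=
  (hρ.comp (Eventually.of_forall fun _ => (A.restrictScalars ℝ).contDiff.contDiffAt)).add
    (SmoothNear.sum fun i _ => Eventually.of_forall fun _ => (hg i).smooth.contDiffAt.comp _
      ((B i).restrictScalars ℝ).contDiff.contDiffAt)

end Sums

/-! ### Positivity of the Levi form over the interior of Ω. -/

section Positivity

variable {E : Type*} [NormedAddCommGroup E] [NormedSpace ℂ E]

/-- The lower bound of the complex Hessian of a Diederich–Fornæss defining function. -/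
lemma IsDiederichFornaess.hessian_pos {D : Set E} {ρ : E → ℝ} {s : ℝ}
    (h : IsDiederichFornaess D ρ s) {z : E} (hz : z ∈ D) (hsm : ContDiffAt ℝ 2 ρ z)
    (hneg : ρ z < 0) {t : E} (ht : t ≠ 0) :
    0 < -ρ z * (complexHessian ρ z t t).re
      + (1 - s) * ‖del (fun x => (ρ x : ℂ)) z t‖ ^ 2 := by
  obtain ⟨hs, -, hpsh⟩ := h
  have hpos := hpsh z hz t ht
  have h1 : ∀ x < (0 : ℝ), HasDerivAt (fun x => -(-x) ^ s) (s * (-x) ^ (s - 1)) x := by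
    intro x hx
    exact ((hasDerivAt_neg x).rpow_const (p := s) (Or.inl (by linarith))).neg.congr_deriv (by ring)
  have h2 : HasDerivAt (fun x => s * (-x) ^ (s - 1)) (s * (1 - s) * (-ρ z) ^ (s - 1 - 1)) (ρ z) := by
    exact (((hasDerivAt_neg (ρ z)).rpow_const (p := s - 1)
      (Or.inl (by linarith))).const_mul s).congr_deriv (by ring)
  have hφ : ContDiffAt ℝ 2 (fun x : ℝ => -(-x) ^ s) (ρ z) :=
    (contDiffAt_id.neg.rpow_const_of_ne (by simpa using hneg.ne)).neg
  rw [complexHessian_comp_real (φ := fun x => -(-x) ^ s) hsm hφ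
    ((eventually_lt_nhds hneg).mono h1) h2] at hpos
  have hR : 0 < -ρ z := by linarith
  rw [Real.rpow_sub_one hR.ne' (s - 1)] at hpos
  -- With φ(x) = −(−x)^s, both φ'(ρ) and φ''(ρ) contain the positive factor s(−ρ)^(s−2); dividing by
  -- it leaves −ρ and 1 − s.
  have hc : 0 < s * (-ρ z) ^ (s - 1) / (-ρ z) :=
    div_pos (mul_pos hs (Real.rpow_pos_of_pos hR _)) hR
  refine pos_of_mul_pos_right (a := s * (-ρ z) ^ (s - 1) / (-ρ z)) ?_ hc.le
  refine hpos.trans_eq ?_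
  generalize (-ρ z) ^ (s - 1) = P
  have := hneg.ne
  field_simp
  ring

/-- Positivity of the Levi form of `ρ + ∑ g i` at the points over the interior, in the directions
where no component with `w i = 0` occurs. -/
lemma levi_pos_of_diederichFornaess {m : ℕ} {D : Set E} {ρ : E → ℝ} {s : ℝ}
    (h : IsDiederichFornaess D ρ s) {g : Fin m → ℂ → ℝ} (hg : ∀ i, IsAdmissibleSummand (g i))
    {z : E} (hz : z ∈ D) (hsm : ContDiffAt ℝ 2 ρ z) (hneg : ρ z < 0) {w : Fin m → ℂ}
    (hzw : ρ z + ∑ i, g i (w i) = 0) {t : E} {τ : Fin m → ℂ} (hτ : ∀ i, w i = 0 → τ i = 0)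
    (htan : del (fun x => (ρ x : ℂ)) z t + ∑ i, dw (g i) (w i) * τ i = 0)
    (hne : t ≠ 0 ∨ τ ≠ 0) :
    0 < (complexHessian ρ z t t).re + ∑ i, (dwdwBar (g i) (w i)).re * ‖τ i‖ ^ 2 := by
  have hterm : ∀ i, 0 ≤ (dwdwBar (g i) (w i)).re * ‖τ i‖ ^ 2 := fun i =>
    mul_nonneg ((hg i).psh _) (sq_nonneg _)
  -- A vertical vector has a nonzero component over some `w i ≠ 0`, where strict subharmonicity
  -- applies.
  by_cases ht : t = 0
  · obtain ⟨i, hi⟩ := Function.ne_iff.mp (hne.resolve_left (not_not.mpr ht))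
    have hwi : w i ≠ 0 := fun h0 => hi (hτ i h0)
    rw [ht, complexHessian_zero_left, Complex.zero_re, zero_add]
    refine Finset.sum_pos' (fun i _ => hterm i) ⟨i, Finset.mem_univ i, ?_⟩
    exact mul_pos ((hg i).strictly_psh _ hwi 1 one_ne_zero) (pow_pos (norm_pos_iff.mpr hi) 2)
  · have hpos := h.hessian_pos hz hsm hneg ht
    have hs : 0 < s := h.1
    have hd : ‖del (fun x => (ρ x : ℂ)) z t‖ ≤ ∑ i, ‖dw (g i) (w i)‖ * ‖τ i‖ := by
      rw [eq_neg_of_add_eq_zero_left htan, norm_neg]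
      refine (norm_sum_le _ _).trans_eq (Finset.sum_congr rfl fun i _ => norm_mul _ _)
    -- Cauchy–Schwarz with log-subharmonicity in each term. As `∑ g i = -ρ z` on the boundary, it
    -- bounds `‖∂ρ(t)‖²` by `-ρ z` times the vertical part of the Levi form; this exceeds the needed
    -- `(1 - s) * ‖∂ρ(t)‖²`.
    have hcs := Finset.sum_sq_le_sum_mul_sum_of_sq_le_mul Finset.univ
      (r := fun i => ‖dw (g i) (w i)‖ * ‖τ i‖) (f := fun i => g i (w i))
      (g := fun i => (dwdwBar (g i) (w i)).re * ‖τ i‖ ^ 2) (fun i _ => (hg i).nonneg _)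
      (fun i _ => hterm i) (fun i _ => by
        rw [mul_pow, ← mul_assoc]
        exact mul_le_mul_of_nonneg_right ((hg i).norm_dw_sq_le _) (sq_nonneg _))
    have hd2 := (pow_le_pow_left₀ (norm_nonneg _) hd 2).trans hcs
    have hR : ∑ i, g i (w i) = -ρ z := by linarith
    rw [hR] at hd2
    have hsd := mul_nonneg hs.le (sq_nonneg ‖del (fun x => (ρ x : ℂ)) z t‖)
    refine pos_of_mul_pos_right (a := -ρ z) ?_ (by linarith)
    rw [mul_add]
    linarith

end Positivity

/-! ### Boundary points and the splitting of the coordinates. -/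

section Boundary

variable {n m : ℕ}

/-- Since `h ≥ 0`, the domain projects into Ω. Hence boundary points lie over `closure Ω ⊆ U`, away
from the edge of `U`, and near them the domain is given by `r < 0` alone. -/
lemma fst_mem_closure_of_mem_frontier {Ω U : Set (Fin n → ℂ)} {ρ : (Fin n → ℂ) → ℝ}
    {h : (Fin m → ℂ) → ℝ} (hρ : IsDefiningFunction Ω U ρ) (hh : ∀ w, 0 ≤ h w)
    {p : (Fin n → ℂ) × (Fin m → ℂ)} (hp : p ∈ frontier (hartogsDomain U ρ h)) :
    p.1 ∈ closure Ω := by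
  refine map_mem_closure continuous_fst (frontier_subset_closure hp) fun q hq => ?_
  have h1 : ρ q.1 + h q.2 < 0 := hq.2
  rw [hρ.eq_neg]
  exact ⟨hq.1, by linarith [hh q.2]⟩

lemma hartogsFun_eq_zero_of_mem_frontier {U : Set (Fin n → ℂ)} {ρ : (Fin n → ℂ) → ℝ}
    {h : (Fin m → ℂ) → ℝ} {p : (Fin n → ℂ) × (Fin m → ℂ)}
    (hp : p ∈ frontier (hartogsDomain U ρ h))
    (hD : ∀ᶠ q in 𝓝 p, q ∈ hartogsDomain U ρ h ↔ hartogsFun ρ h q < 0)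
    (hc : ContinuousAt (hartogsFun ρ h) p) : hartogsFun ρ h p = 0 := by
  rcases lt_trichotomy (hartogsFun ρ h p) 0 with hlt | heq | hgt
  · refine absurd (mem_interior_iff_mem_nhds.mpr ?_) hp.2
    filter_upwards [hD, hc.eventually_lt_const hlt] with q h1 h2 using h1.mpr h2
  · exact heq
  · obtain ⟨q, hq1, hq2⟩ := ((mem_closure_iff_frequently.mp hp.1).and_eventually
      (hc.eventually_const_lt hgt)).exists
    exact absurd hq1.2 hq2.not_gt

/-- The vectors without components along the coordinates `w i` with `a i = 0`. -/
def supportedSubmodule (n : ℕ) (a : Fin m → ℂ) : Submodule ℂ ((Fin n → ℂ) × (Fin m → ℂ)) where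
  carrier := {x | ∀ i, a i = 0 → x.2 i = 0}
  add_mem' hx hy i hi := by simp [hx i hi, hy i hi]
  zero_mem' i _ := rfl
  smul_mem' c x hx i hi := by simp [hx i hi]

/-- The coordinate vectors along the coordinates `w i` with `a i = 0`. -/
def vanishingCoord (n : ℕ) (a : Fin m → ℂ) (i : {i // a i = 0}) : (Fin n → ℂ) × (Fin m → ℂ) :=
  (0, Pi.single (i : Fin m) 1)

lemma linearIndependent_vanishingCoord (a : Fin m → ℂ) :
    LinearIndependent ℂ (vanishingCoord n a) := by
  have h1 := (Pi.linearIndependent_single_one (Fin m) ℂ).comp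
    (Subtype.val : {i // a i = 0} → Fin m) Subtype.val_injective
  exact h1.map' (LinearMap.inr ℂ (Fin n → ℂ) (Fin m → ℂ))
    (LinearMap.ker_eq_bot.mpr LinearMap.inr_injective)

lemma isCompl_supportedSubmodule (a : Fin m → ℂ) :
    IsCompl (supportedSubmodule n a) (Submodule.span ℂ (Set.range (vanishingCoord n a))) := by
  constructor
  · rw [Submodule.disjoint_def]
    intro x hx hx'
    have h : x.1 = 0 ∧ ∀ i, a i ≠ 0 → x.2 i = 0 := by
      clear hx
      induction hx' using Submodule.span_induction with
      | mem x hx =>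
        obtain ⟨j, rfl⟩ := hx
        refine ⟨rfl, fun i hi => Pi.single_eq_of_ne (fun hij => hi ?_) _⟩
        rw [hij]
        exact j.2
      | zero => exact ⟨rfl, fun _ _ => rfl⟩
      | add x y _ _ h1 h2 =>
        exact ⟨by simp [h1.1, h2.1], fun i hi => by simp [h1.2 i hi, h2.2 i hi]⟩
      | smul c x _ h1 => exact ⟨by simp [h1.1], fun i hi => by simp [h1.2 i hi]⟩
    refine Prod.ext h.1 (funext fun i => ?_)
    by_cases hi : a i = 0
    · exact hx i hi
    · exact h.2 i hi
  · rw [codisjoint_iff, Submodule.eq_top_iff']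
    intro x
    refine Submodule.mem_sup.mpr ⟨x - ∑ i : {i // a i = 0}, x.2 i • vanishingCoord n a i, ?_,
      ∑ i : {i // a i = 0}, x.2 i • vanishingCoord n a i,
      Submodule.sum_mem _ fun i _ => Submodule.smul_mem _ _ (Submodule.subset_span ⟨i, rfl⟩),
      sub_add_cancel _ _⟩
    intro i hi
    have : (∑ j : {i // a i = 0}, x.2 j • vanishingCoord n a j).2 i = x.2 i := by
      rw [Prod.snd_sum, Finset.sum_apply, Finset.sum_eq_single ⟨i, hi⟩]
      · simp [vanishingCoord]
      · intro j _ hj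
        have : i ≠ j := fun h => hj (Subtype.ext h.symm)
        simp [vanishingCoord, this]
      · simp
    simp [this]

end Boundary

/-- If the Levi form of `ρ` at `z` has corank at most one, two vectors of its radical are
dependent. -/
lemma not_linearIndependent_of_leviRank {n : ℕ} {ρ : (Fin n → ℂ) → ℝ} {z : Fin n → ℂ}
    (hz : del (fun x => (ρ x : ℂ)) z ≠ 0) (hrank : n ≤ leviRank ρ z + 2) {x y : Fin n → ℂ}
    (hx : x ∈ complexTangent ρ z) (hy : y ∈ complexTangent ρ z)
    (hx' : ∀ t ∈ complexTangent ρ z, complexHessian ρ z x t = 0)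
    (hy' : ∀ t ∈ complexTangent ρ z, complexHessian ρ z y t = 0) :
    ¬ LinearIndependent ℂ ![x, y] := by
  intro hli
  let K := LinearMap.ker (leviMap ρ z)
  have hxK : (⟨x, hx⟩ : complexTangent ρ z) ∈ K := LinearMap.mem_ker.mpr
    (funext fun t => hx' t t.2)
  have hyK : (⟨y, hy⟩ : complexTangent ρ z) ∈ K := LinearMap.mem_ker.mpr
    (funext fun t => hy' t t.2)
  have hK : LinearIndependent ℂ (![⟨⟨x, hx⟩, hxK⟩, ⟨⟨y, hy⟩, hyK⟩] : Fin 2 → K) := by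
    rw [LinearIndependent.pair_iff] at hli ⊢
    intro a b hab
    exact hli a b (congrArg (fun v : K => ((v : complexTangent ρ z) : Fin n → ℂ)) hab)
  have h1 := hK.fintype_card_le_finrank
  have h2 := LinearMap.finrank_range_add_finrank_ker (leviMap ρ z)
  rw [finrank_complexTangent hz, Module.finrank_fin_fun] at h2
  have h3 : leviRank ρ z + Module.finrank ℂ K = n - 1 := h2
  rw [Fintype.card_fin] at h1
  -- Two independent radical vectors would force the rank down to at most `n - 3`.
  omega

end Hartogs

/-! ### The two kinds of boundary points. -/

theorem mainTheorem5 (n m : ℕ) (Ω U : Set (Fin n → ℂ)) (ρ : (Fin n → ℂ) → ℝ) (s : ℝ)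
    (h : (Fin m → ℂ) → ℝ)
    (hΩ : Hartogs.IsSmoothBoundedPseudoconvex Ω U ρ)
    (hρ : Hartogs.IsDiederichFornaess Ω ρ s)
    (hh : Hartogs.ConditionIII h)
    (hrank : ∀ z ∈ frontier Ω, n ≤ Hartogs.leviRank ρ z + 2) :
    ∀ p ∈ frontier (Hartogs.hartogsDomain U ρ h),
      Hartogs.HasLocallyDiagonalizableLeviFormAt
        (Hartogs.hartogsDomain U ρ h) (Hartogs.hartogsFun ρ h) p := by
  open Hartogs in
  intro p hp
  obtain ⟨g, hg, hgh⟩ := hh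
  have hdef := hΩ.defining
  have hh0 : ∀ w, 0 ≤ h w := fun w => by
    rw [hgh]
    exact Finset.sum_nonneg fun i _ => (hg i).nonneg _
  let A : (Fin n → ℂ) × (Fin m → ℂ) →L[ℂ] (Fin n → ℂ) := ContinuousLinearMap.fst ℂ _ _
  let B : Fin m → (Fin n → ℂ) × (Fin m → ℂ) →L[ℂ] ℂ := fun i =>
    (ContinuousLinearMap.proj i).comp (ContinuousLinearMap.snd ℂ _ _)
  have hr : hartogsFun ρ h = fun x => ρ (A x) + ∑ i, g i (B i x) := by
    funext x
    exact congrArg (ρ x.1 + ·) (hgh x.2)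
  have hpcl : p.1 ∈ closure Ω := fst_mem_closure_of_mem_frontier hdef hh0 hp
  have hpU : p.1 ∈ U := hdef.closure_subset hpcl
  have hρs : SmoothNear ρ p.1 := by
    filter_upwards [hdef.isOpen.mem_nhds hpU] with z hz
    exact hdef.smooth.contDiffAt (hdef.isOpen.mem_nhds hz)
  have hρ2 := hρs.eventually_contDiffAt_two
  have hrs : SmoothNear (hartogsFun ρ h) p := by
    rw [hr]
    exact smoothNear_add_sum_comp (A := A) hρs hg
  have hD : ∀ᶠ q in 𝓝 p, q ∈ hartogsDomain U ρ h ↔ hartogsFun ρ h q < 0 := by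
    filter_upwards [continuousAt_fst.eventually (hdef.isOpen.mem_nhds hpU)] with q hq
    exact ⟨fun hq' => hq'.2, fun hq' => ⟨hq, hq'⟩⟩
  have hzero := hartogsFun_eq_zero_of_mem_frontier hp hD hrs.continuousAt
  have hzero' : ρ p.1 + ∑ i, g i (p.2 i) = 0 := by
    rw [← hgh]
    exact hzero
  have hdel : ∀ᶠ q in 𝓝 p, ∀ t, del (fun x => (hartogsFun ρ h x : ℂ)) q t
      = del (fun x => (ρ x : ℂ)) q.1 t.1 + ∑ i, dw (g i) (q.2 i) * t.2 i := by
    filter_upwards [continuousAt_fst.eventually hρ2] with q hq t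
    rw [hr]
    exact del_add_sum_comp (A := A) (B := B) hq hg t
  have hhess : ∀ᶠ q in 𝓝 p, ∀ x t, complexHessian (hartogsFun ρ h) q x t
      = complexHessian ρ q.1 x.1 t.1
        + ∑ i, dwdwBar (g i) (q.2 i) * x.2 i * (starRingEnd ℂ) (t.2 i) := by
    filter_upwards [continuousAt_fst.eventually hρ2] with q hq x t
    rw [hr]
    exact complexHessian_add_sum_comp (A := A) (B := B) hq hg x t
  have hcoord : ∀ i, ∀ᶠ q in 𝓝 p, ∀ t, complexHessian (hartogsFun ρ h) q
      (vanishingCoord n p.2 i) t = dwdwBar (g i) (q.2 i) * (starRingEnd ℂ) (t.2 i) := by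
    intro i
    filter_upwards [hhess] with q hq t
    rw [hq, Finset.sum_eq_single (i : Fin m)]
    · simp [vanishingCoord, complexHessian_zero_left]
    · intro j _ hj
      simp [vanishingCoord, hj]
    · simp
  -- The splitting and the factors `α` serve all boundary points alike; only a transversal vector in
  -- `W` and the bound on the radical depend on whether `w` vanishes.
  have main : ∀ ν : (Fin n → ℂ) × (Fin m → ℂ), ν ∈ supportedSubmodule n p.2 →
      del (fun x => (hartogsFun ρ h x : ℂ)) p ν ≠ 0 →
      (∀ x ∈ supportedSubmodule n p.2 ⊓ complexTangent (hartogsFun ρ h) p,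
        ∀ y ∈ supportedSubmodule n p.2 ⊓ complexTangent (hartogsFun ρ h) p,
        (∀ t ∈ supportedSubmodule n p.2 ⊓ complexTangent (hartogsFun ρ h) p,
          complexHessian (hartogsFun ρ h) p x t = 0) →
        (∀ t ∈ supportedSubmodule n p.2 ⊓ complexTangent (hartogsFun ρ h) p,
          complexHessian (hartogsFun ρ h) p y t = 0) → ¬ LinearIndependent ℂ ![x, y]) →
      HasLocallyDiagonalizableLeviFormAt (hartogsDomain U ρ h) (hartogsFun ρ h) p := by
    intro ν hνW hν hrad
    refine hasLocallyDiagonalizableLeviFormAt_of_decomposition hrs hD (supportedSubmodule n p.2)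
      (vanishingCoord n p.2) (linearIndependent_vanishingCoord p.2)
      (isCompl_supportedSubmodule p.2) (fun i => ?_) (fun i j hij => ?_) (fun i => ?_) hνW hν hrad
    · filter_upwards [hcoord i] with q hq t ht
      rw [hq, ht i i.2, map_zero, mul_zero]
    · filter_upwards [hcoord i] with q hq
      have hij' : (i : Fin m) ≠ j := fun h => hij (Subtype.ext h)
      rw [hq]
      simp [vanishingCoord, hij']
    · obtain ⟨V, α, hV, h0V, hαs, hα0, hα⟩ := (hg i).exists_factor
      have hBi : ContinuousAt (fun q => B i q) p := (B i).continuous.continuousAt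
      have hpi : B i p = 0 := i.2
      have hVp : ∀ᶠ q in 𝓝 p, B i q ∈ V :=
        hBi.eventually (hV.mem_nhds (by simpa only [hpi] using h0V))
      refine ⟨fun q => α (B i q), ?_, ?_, ?_⟩
      · filter_upwards [hVp] with q hq
        exact (hαs.contDiffAt (hV.mem_nhds hq)).comp q
          ((B i).restrictScalars ℝ).contDiff.contDiffAt
      · dsimp only
        rw [hpi]
        -- The limit is along the full neighbourhood filter of `0`, so it is also the value `α 0`.
        exact eq_of_tendsto_nhds hα0
      · filter_upwards [hVp, hdel, hcoord i] with q h1 h2 h3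
        rw [h2, h3, Finset.sum_eq_single (i : Fin m)]
        · have h4 := hα _ h1
          simp [vanishingCoord]
          exact h4
        · intro j _ hj
          simp [vanishingCoord, hj]
        · simp
  -- Over `∂Ω` all the `w i` vanish, `W` is `ℂⁿ × 0`, and the form on `W ⊓ T` is the Levi form of
  -- `ρ`.
  by_cases hw : p.2 = 0
  · have hρ0 : ρ p.1 = 0 := by
      have : ∑ i, g i (p.2 i) = 0 := Finset.sum_eq_zero fun i _ => by
        rw [hw]
        exact ((hg i).eq_zero_iff 0).mpr rfl
      rwa [this, add_zero] at hzero'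
    have hfr : p.1 ∈ frontier Ω := by
      refine ⟨hpcl, fun hint => ?_⟩
      have := interior_subset hint
      rw [hdef.eq_neg] at this
      exact this.2.ne hρ0
    have hdρ : del (fun x => (ρ x : ℂ)) p.1 ≠ 0 := fun h0 => hdef.grad_ne _ hfr
      ((del_ofReal_eq_zero_iff (hρ2.self_of_nhds.differentiableAt (by simp))).mp h0)
    obtain ⟨t, ht⟩ : ∃ t, del (fun x => (ρ x : ℂ)) p.1 t ≠ 0 := by
      by_contra! hcon
      exact hdρ (LinearMap.ext hcon)
    have hW : ∀ x ∈ supportedSubmodule n p.2, x.2 = 0 := fun x hx =>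
      funext fun i => hx i (by rw [hw]; rfl)
    have htan : ∀ t, t ∈ complexTangent ρ p.1 → (t, (0 : Fin m → ℂ)) ∈
        supportedSubmodule n p.2 ⊓ complexTangent (hartogsFun ρ h) p := by
      intro t ht
      refine ⟨fun _ _ => rfl, ?_⟩
      change del (fun x => (hartogsFun ρ h x : ℂ)) p (t, 0) = 0
      have ht' : del (fun x => (ρ x : ℂ)) p.1 t = 0 := ht
      rw [hdel.self_of_nhds]
      simpa using ht'
    have htan' : ∀ x ∈ supportedSubmodule n p.2 ⊓ complexTangent (hartogsFun ρ h) p,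
        x.1 ∈ complexTangent ρ p.1 := by
      intro x hx
      have : del (fun x => (hartogsFun ρ h x : ℂ)) p x = 0 := hx.2
      rw [hdel.self_of_nhds, hW x hx.1] at this
      change del (fun x => (ρ x : ℂ)) p.1 x.1 = 0
      simpa using this
    have hradical : ∀ x, (∀ t ∈ supportedSubmodule n p.2 ⊓ complexTangent (hartogsFun ρ h) p,
        complexHessian (hartogsFun ρ h) p x t = 0) →
        ∀ t ∈ complexTangent ρ p.1, complexHessian ρ p.1 x.1 t = 0 := by
      intro x hx t ht
      have := hx _ (htan t ht)
      rw [hhess.self_of_nhds] at this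
      simpa using this
    refine main (t, 0) (fun _ _ => rfl) ?_ fun x hx y hy hx' hy' hli => ?_
    · rw [hdel.self_of_nhds]
      simpa using ht
    · refine not_linearIndependent_of_leviRank hdρ (hrank _ hfr) (htan' x hx) (htan' y hy)
        (hradical x hx') (hradical y hy') ?_
      rw [LinearIndependent.pair_iff] at hli ⊢
      intro a b hab
      refine hli a b (Prod.ext hab ?_)
      simp [hW x hx.1, hW y hy.1]
  · obtain ⟨j, hj⟩ := Function.ne_iff.mp hw
    have hneg : ρ p.1 < 0 := by
      have hpos : 0 < ∑ i, g i (p.2 i) := Finset.sum_pos' (fun i _ => (hg i).nonneg _)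
        ⟨j, Finset.mem_univ j, ((hg j).nonneg _).lt_of_ne fun h0 =>
          hj (((hg j).eq_zero_iff _).mp h0.symm)⟩
      linarith
    have hpΩ : p.1 ∈ Ω := by
      rw [hdef.eq_neg]
      exact ⟨hpU, hneg⟩
    refine main (0, Pi.single j 1) (fun i hi => Pi.single_eq_of_ne (fun hij => hj ?_) _) ?_
      fun x hx y _ hx' _ hli => ?_
    · rw [← hij]
      exact hi
    · rw [hdel.self_of_nhds, Finset.sum_eq_single j]
      · simpa using (hg j).dw_ne_zero hj
      · intro i _ hi
        simp [hi]
      · simp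
    -- Here the form is positive definite on `W ⊓ T`, so one nonzero radical vector, paired with
    -- itself, is already contradictory.
    · have hxne : x ≠ 0 := by simpa using hli.ne_zero 0
      have h1 : del (fun x => (hartogsFun ρ h x : ℂ)) p x = 0 := hx.2
      rw [hdel.self_of_nhds] at h1
      have hpos := levi_pos_of_diederichFornaess hρ hg hpΩ hρ2.self_of_nhds hneg hzero' hx.1 h1
        (by
          by_contra! hcon
          exact hxne (Prod.ext hcon.1 hcon.2))
      have h2 := congrArg Complex.re (hx' x hx)
      rw [hhess.self_of_nhds, Complex.add_re, Complex.re_sum, Complex.zero_re] at h2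
      refine hpos.ne' (Eq.trans ?_ h2)
      congr 1
      refine Finset.sum_congr rfl fun i _ => ?_
      rw [mul_assoc, Complex.mul_conj, Complex.normSq_eq_norm_sq, Complex.re_mul_ofReal]
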